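/- Let $K$ be a field and let $\mathcal U,\mathcal T$ be dualizing $K$-varieties. That is, each is a skeletally small additive $K$-linear category $\mathcal C$ with split idempotents and finite-dimensional morphism spaces, such that $D=\mathrm{Hom}_K(-,K)$ restricts to a duality $\mathrm{mod}(\mathcal C)\to\mathrm{mod}(\mathcal C^{op})$. Here $\mathrm{Mod}(\mathcal C)$ denotes the category of additive functors $\mathcal C\to\mathbf{Ab}$, and $\mathrm{mod}(\mathcal C)$ is its full subcategory of finitely presented functors, i.e. those $N$ admitting an exact sequence $P_1\to P_0\to N\to 0$ with $P_0,P_1$ finitely generated projective. Let $M\in\mathrm{Mod}(\mathcal U\otimes_K\mathcal T^{op})$. For $T\in\mathcal T$ and $U\in\mathcal U$ write $M_T=M(-,T)\in\mathrm{Mod}(\mathcal U)$ and $M_U=M(U,-)\in\mathrm{Mod}(\mathcal T^{op})$, and assume that $M_T\in\mathrm{mod}(\mathcal U)$ for all $T$ and $M_U\in\mathrm{mod}(\mathcal T^{op})$ for all $U$. Let $\mathbf\Lambda=\left[\begin{smallmatrix}\mathcal T&0\\ M&\mathcal U\end{smallmatrix}\right]$ be the triangular matrix category. Its objects are pairs $(T,U)$;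 a morphism $(T,U)\to(T',U')$ is a matrix $\left[\begin{smallmatrix}t&0\\ m&u\end{smallmatrix}\right]$ with $t\in\mathcal T(T,T')$, $m\in M(U',T)$, $u\in\mathcal U(U,U')$; addition is entrywise and composition is matrix multiplication, the lower left entry of $\left[\begin{smallmatrix}t_2&0\\ m_2&u_2\end{smallmatrix}\right]\left[\begin{smallmatrix}t_1&0\\ m_1&u_1\end{smallmatrix}\right]$ being $M(1\otimes t_1^{op})(m_2)+M(u_2\otimes 1)(m_1)$. Let $\mathbb G:\mathrm{Mod}(\mathcal U)\to\mathrm{Mod}(\mathcal T)$ be the functor $\mathbb G(B)(T)=\mathrm{Hom}_{\mathrm{Mod}(\mathcal U)}(M_T,B)$, and let $(\mathrm{Mod}(\mathcal T),\mathbb G\,\mathrm{Mod}(\mathcal U))$ be the comma category of triples $(A,f,B)$ with $f:A\to\mathbb G(B)$ a morphism of $\mathcal T$-modules. Let $\mathfrak F:(\mathrm{Mod}(\mathcal T),\mathbb G\,\mathrm{Mod}(\mathcal U))\to\mathrm{Mod}(\mathbf\Lambda)$ be the functor sending $(A,f,B)$ to the $\mathbf\Lambda$-module with value $A(T)\oplus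 B(U)$ at $(T,U)$, on which $\left[\begin{smallmatrix}t&0\\ m&u\end{smallmatrix}\right]:(T,U)\to(T',U')$ acts by $(x,y)\mapsto\big(A(t)(x),\,[f_T(x)]_{U'}(m)+B(u)(y)\big)$, and sending a morphism $(\alpha,\beta)$ to the morphism with components $\alpha_T\oplus\beta_U$. Let $(\mathrm{mod}(\mathcal T),\mathbb G\,\mathrm{mod}(\mathcal U))$ be the full subcategory of the comma category on the triples $(A,f,B)$ with $A\in\mathrm{mod}(\mathcal T)$ and $B\in\mathrm{mod}(\mathcal U)$. Then $\mathfrak F$ maps $(\mathrm{mod}(\mathcal T),\mathbb G\,\mathrm{mod}(\mathcal U))$ into $\mathrm{mod}(\mathbf\Lambda)$, and the restricted functor $$\mathfrak F|:\big(\mathrm{mod}(\mathcal T),\mathbb G\,\mathrm{mod}(\mathcal U)\big)\longrightarrow\mathrm{mod}(\mathbf\Lambda)$$ is an equivalence of categories. -/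

import Mathlib

open CategoryTheory CategoryTheory.Limits Opposite
open scoped TensorProduct

universe v u

namespace TriMat

noncomputable section

/-! ### Modules over a preadditive category -/

/-- `Mod(C)`: additive functors from `C` to abelian groups, with natural transformations.
The abelian groups live in the universe `max u v`, in which every category `C : Type u` with
morphisms in `Type v` is small; it contains all groups `C(X, Y)` up to isomorphism. -/
abbrev Mod (C : Type u) [Category.{v} C] [Preadditive C] :=
  C ⥤+ AddCommGrpCat.{max u v}

section Modules

variable {C : Type u} [Category.{v} C] [Preadditive C]

/-- The action `M(f)(x)` of a morphism `f` on an element `x ∈ M(X)`. -/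
def act (M : Mod C) {X Y : C} (f : X ⟶ Y) : M.obj.obj X →+ M.obj.obj Y :=
  (M.obj.map f).hom

@[simp] lemma act_id (M : Mod C) (X : C) (x : M.obj.obj X) : act M (𝟙 X) x = x := by
  simp [act]

@[simp] lemma act_comp (M : Mod C) {X Y Z : C} (f : X ⟶ Y) (g : Y ⟶ Z) (x : M.obj.obj X) :
    act M (f ≫ g) x = act M g (act M f x) := by
  simp [act]

@[simp] lemma act_add (M : Mod C) {X Y : C} (f g : X ⟶ Y) (x : M.obj.obj X) :
    act M (f + g) x = act M f x + act M g x := by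
  simp [act, Functor.map_add]

@[simp] lemma act_zero (M : Mod C) {X Y : C} (x : M.obj.obj X) :
    act M (0 : X ⟶ Y) x = 0 := by
  simp [act]

/-- The component at `X` of a morphism of `C`-modules. -/
def app {M N : Mod C} (η : M ⟶ N) (X : C) : M.obj.obj X →+ N.obj.obj X :=
  (η.hom.app X).hom

@[simp] lemma app_act {M N : Mod C} (η : M ⟶ N) {X Y : C} (f : X ⟶ Y) (x : M.obj.obj X) :
    app η Y (act M f x) = act N f (app η X x) :=
  ConcreteCategory.congr_hom (η.hom.naturality f) x

@[simp] lemma app_id (M : Mod C) (X : C) (x : M.obj.obj X) : app (𝟙 M) X x = x := rfl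

@[simp] lemma app_comp {M N P : Mod C} (η : M ⟶ N) (θ : N ⟶ P) (X : C) (x : M.obj.obj X) :
    app (η ≫ θ) X x = app θ X (app η X x) := rfl

@[simp] lemma app_add {M N : Mod C} (η θ : M ⟶ N) (X : C) (x : M.obj.obj X) :
    app (η + θ) X x = app η X x + app θ X x := rfl

lemma hom_ext {M N : Mod C} {η θ : M ⟶ N} (h : ∀ X x, app η X x = app θ X x) : η = θ := by
  apply ObjectProperty.hom_ext
  ext X x
  exact h X x

/-- Build a `C`-module from groups and an action of the morphisms of `C`. -/
def mkMod (obj : C → Type (max u v)) [∀ X, AddCommGroup (obj X)]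
    (map : ∀ {X Y : C}, (X ⟶ Y) → (obj X →+ obj Y))
    (map_id : ∀ X x, map (𝟙 X) x = x)
    (map_comp : ∀ {X Y Z : C} (f : X ⟶ Y) (g : Y ⟶ Z) x, map (f ≫ g) x = map g (map f x))
    (map_add : ∀ {X Y : C} (f g : X ⟶ Y) x, map (f + g) x = map f x + map g x) : Mod C where
  obj :=
    { obj := fun X => AddCommGrpCat.of (obj X)
      map := fun f => AddCommGrpCat.ofHom (map f)
      map_id := fun X => by ext x; exact map_id X x
      map_comp := fun f g => by ext x; exact map_comp f g x }
  property := { map_add := fun {X Y f g} => by ext x; exact map_add f g x }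

/-- Build a morphism of `C`-modules from its components. -/
def mkHom {M N : Mod C} (η : ∀ X, M.obj.obj X →+ N.obj.obj X)
    (h : ∀ {X Y : C} (f : X ⟶ Y) x, η Y (act M f x) = act N f (η X x)) : M ⟶ N :=
  ObjectProperty.homMk
    { app := fun X => AddCommGrpCat.ofHom (η X)
      naturality := fun X Y f => by ext x; exact h f x }

/-- `M` is finitely generated: finitely many elements `xᵢ ∈ M(Xᵢ)` generate it, i.e.
(by the Yoneda lemma) `M` is a quotient of a finite coproduct of functors `C(Xᵢ, -)`. -/
def IsFG (M : Mod C) : Prop :=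
  ∃ (n : ℕ) (X : Fin n → C) (x : ∀ i, M.obj.obj (X i)),
    ∀ (Y : C) (y : M.obj.obj Y), ∃ f : ∀ i, X i ⟶ Y, y = ∑ i, act M (f i) (x i)

/-- `M` is finitely presented: there is an exact sequence `P₁ ⟶ P₀ ⟶ M ⟶ 0` with `P₁`, `P₀`
finitely generated projective; exactness in `Mod(C)` is exactness at every object. -/
def IsFP : ObjectProperty (Mod C) := fun M =>
  ∃ (P₁ P₀ : Mod C) (d : P₁ ⟶ P₀) (p : P₀ ⟶ M),
    IsFG P₁ ∧ Projective P₁ ∧ IsFG P₀ ∧ Projective P₀ ∧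
      ∀ X : C, Function.Exact (app d X) (app p X) ∧ Function.Surjective (app p X)

/-- The category `mod(C)` of finitely presented `C`-modules. -/
abbrev FPMod (C : Type u) [Category.{v} C] [Preadditive C] :=
  (IsFP : ObjectProperty (Mod C)).FullSubcategory

end Modules

/-! ### Dualizing varieties -/

/-- The opposite of a `K`-linear category is `K`-linear. -/
instance linearOp (K : Type*) [CommRing K] (C : Type*) [Category* C] [Preadditive C]
    [Linear K C] : Linear K Cᵒᵖ where
  homModule _ _ :=
    { smul := fun r f => (r • f.unop).op
      one_smul := fun f => Quiver.Hom.unop_inj (one_smul K f.unop)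
      mul_smul := fun r s f => Quiver.Hom.unop_inj (mul_smul r s f.unop)
      smul_zero := fun r => Quiver.Hom.unop_inj (smul_zero r)
      smul_add := fun r f g => Quiver.Hom.unop_inj (smul_add r f.unop g.unop)
      add_smul := fun r s f => Quiver.Hom.unop_inj (add_smul r s f.unop)
      zero_smul := fun f => Quiver.Hom.unop_inj (zero_smul K f.unop) }
  smul_comp _ _ _ r f g := Quiver.Hom.unop_inj (Linear.comp_smul _ _ _ g.unop r f.unop)
  comp_smul _ _ _ f r g := Quiver.Hom.unop_inj (Linear.smul_comp _ _ _ r g.unop f.unop)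

section Duality

variable (K : Type v) [Field K] {C : Type u} [Category.{v} C] [Preadditive C] [Linear K C]

/-- For a module `M` over a `K`-category, `M(X)` is a `K`-vector space, the scalar `k` acting
as `M(k · 1_X)`. -/
@[reducible] def scalarModule (M : Mod C) (X : C) : Module K (M.obj.obj X) where
  smul k x := act M (k • 𝟙 X) x
  one_smul x := by
    change act M ((1 : K) • 𝟙 X) x = x
    rw [one_smul, act_id]
  mul_smul k l x := by
    change act M ((k * l) • 𝟙 X) x = act M (k • 𝟙 X) (act M (l • 𝟙 X) x)
    rw [← act_comp, Linear.smul_comp, Category.id_comp, smul_smul, mul_comm]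
  smul_zero k := map_zero _
  smul_add k x y := map_add _ x y
  add_smul k l x := by
    change act M ((k + l) • 𝟙 X) x = act M (k • 𝟙 X) x + act M (l • 𝟙 X) x
    rw [add_smul, act_add]
  zero_smul x := by
    change act M ((0 : K) • 𝟙 X) x = 0
    rw [zero_smul, act_zero]

attribute [local instance] scalarModule

/-- `M(f)` as a `K`-linear map. -/
def actLin (M : Mod C) {X Y : C} (f : X ⟶ Y) : M.obj.obj X →ₗ[K] M.obj.obj Y where
  toFun := act M f
  map_add' := map_add _
  map_smul' k x := by
    change act M f (act M (k • 𝟙 X) x) = act M (k • 𝟙 Y) (act M f x)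
    rw [← act_comp, ← act_comp, Linear.smul_comp, Linear.comp_smul, Category.id_comp,
      Category.comp_id]

/-- A component of a morphism of modules, as a `K`-linear map. -/
def appLin {M N : Mod C} (η : M ⟶ N) (X : C) : M.obj.obj X →ₗ[K] N.obj.obj X where
  toFun := app η X
  map_add' := map_add _
  map_smul' k x := app_act η (k • 𝟙 X) x

/-- The dual `D(M) = Hom_K(M(-), K)` of a `C`-module, a module over `Cᵒᵖ`. -/
def dualObj (M : Mod C) : Mod Cᵒᵖ :=
  mkMod (fun X => M.obj.obj X.unop →ₗ[K] K)
    (fun f =>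
      { toFun := fun φ => φ ∘ₗ actLin K M f.unop
        map_zero' := rfl
        map_add' := fun _ _ => rfl })
    (fun X φ => by ext x; exact congrArg φ (act_id M X.unop x))
    (fun f g φ => by ext x; exact congrArg φ (act_comp M g.unop f.unop x))
    (fun f g φ => by
      ext x
      exact (congrArg φ (act_add M f.unop g.unop x)).trans (map_add φ _ _))

/-- The contravariant functor `D = Hom_K(-, K)` from `C`-modules to `Cᵒᵖ`-modules. -/
def dual : (Mod C)ᵒᵖ ⥤ Mod Cᵒᵖ where
  obj M := dualObj K M.unop
  map η := mkHom (M := dualObj K _) (N := dualObj K _)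
    (fun X =>
      { toFun := fun φ => LinearMap.comp (M₃ := K) φ (appLin K η.unop X.unop)
        map_zero' := rfl
        map_add' := fun _ _ => rfl })
    (fun f φ => LinearMap.ext fun x =>
      congrArg (show _ →ₗ[K] K from φ) (app_act η.unop f.unop x).symm)
  map_id _ := rfl
  map_comp _ _ := rfl

/-- A `K`-category `C` is a dualizing `K`-variety: it is additive, its idempotents split, its
morphism spaces are finite-dimensional, and `D = Hom_K(-, K)` restricts to a duality
(a contravariant equivalence) from `mod(C)` to `mod(Cᵒᵖ)`. -/
structure IsDualizingVariety (C : Type u) [Category.{v} C] [Preadditive C] [Linear K C] :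
    Prop where
  hasFiniteBiproducts : HasFiniteBiproducts C
  isIdempotentComplete : IsIdempotentComplete C
  homFinite : ∀ X Y : C, Module.Finite K (X ⟶ Y)
  duality : ∃ h : ∀ M : (FPMod C)ᵒᵖ, IsFP ((IsFP.ι.op ⋙ dual K (C := C)).obj M),
    (IsFP.lift (IsFP.ι.op ⋙ dual K (C := C)) h).IsEquivalence

end Duality

/-! ### The tensor product of `K`-categories -/

/-- The tensor product `C ⊗_K D` of two `K`-categories: its objects are pairs of objects. -/
structure TensorCat (K : Type*) (C : Type*) (D : Type*) where
  fst : C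
  snd : D

namespace TensorCat

variable (K : Type*) [CommRing K] {C : Type*} {D : Type*} [Category* C] [Category* D]
  [Preadditive C] [Preadditive D] [Linear K C] [Linear K D]

/-- Composition, `(f ⊗ g) ≫ (f' ⊗ g') = (f ≫ f') ⊗ (g ≫ g')`, as a bilinear map. -/
def compMap (X Y Z : TensorCat K C D) :
    ((X.fst ⟶ Y.fst) ⊗[K] (X.snd ⟶ Y.snd)) →ₗ[K]
      ((Y.fst ⟶ Z.fst) ⊗[K] (Y.snd ⟶ Z.snd)) →ₗ[K]
        ((X.fst ⟶ Z.fst) ⊗[K] (X.snd ⟶ Z.snd)) :=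
  TensorProduct.map₂ (Linear.comp X.fst Y.fst Z.fst) (Linear.comp X.snd Y.snd Z.snd)

@[simp] lemma compMap_tmul (X Y Z : TensorCat K C D) (f : X.fst ⟶ Y.fst) (g : X.snd ⟶ Y.snd)
    (f' : Y.fst ⟶ Z.fst) (g' : Y.snd ⟶ Z.snd) :
    compMap K X Y Z (f ⊗ₜ g) (f' ⊗ₜ g') = (f ≫ f') ⊗ₜ (g ≫ g') := rfl

instance category : Category (TensorCat K C D) where
  Hom X Y := (X.fst ⟶ Y.fst) ⊗[K] (X.snd ⟶ Y.snd)
  id X := 𝟙 X.fst ⊗ₜ 𝟙 X.snd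
  comp {X Y Z} a b := compMap K X Y Z a b
  id_comp {X Y} a := by
    induction a using TensorProduct.induction_on with
    | zero => simp
    | tmul f g => simp
    | add a b ha hb => rw [map_add, ha, hb]
  comp_id {X Y} a := by
    induction a using TensorProduct.induction_on with
    | zero => simp
    | tmul f g => simp
    | add a b ha hb => rw [map_add, LinearMap.add_apply, ha, hb]
  assoc {W X Y Z} a b c := by
    induction a using TensorProduct.induction_on with
    | zero => simp
    | add a a' ha ha' => simp only [map_add, LinearMap.add_apply, ha, ha']
    | tmul f g =>
      induction b using TensorProduct.induction_on with
      | zero => simp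
      | add b b' hb hb' => simp only [map_add, LinearMap.add_apply, hb, hb']
      | tmul f' g' =>
        induction c using TensorProduct.induction_on with
        | zero => simp
        | add c c' hc hc' => simp only [map_add, hc, hc']
        | tmul f'' g'' => simp

instance preadditive : Preadditive (TensorCat K C D) where
  homGroup X Y := inferInstanceAs (AddCommGroup ((X.fst ⟶ Y.fst) ⊗[K] (X.snd ⟶ Y.snd)))
  add_comp X Y Z a a' b := LinearMap.map_add₂ (compMap K X Y Z) a a' b
  comp_add X Y Z a b b' := (compMap K X Y Z a).map_add b b'

/-- The morphism `f ⊗ g` of the tensor product category. -/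
def tmul {A A' : C} {B B' : D} (f : A ⟶ A') (g : B ⟶ B') :
    (⟨A, B⟩ : TensorCat K C D) ⟶ ⟨A', B'⟩ :=
  (f ⊗ₜ[K] g : (A ⟶ A') ⊗[K] (B ⟶ B'))

lemma tmul_id (A : C) (B : D) : tmul K (𝟙 A) (𝟙 B) = 𝟙 (⟨A, B⟩ : TensorCat K C D) := rfl

lemma tmul_comp {A A' A'' : C} {B B' B'' : D} (f : A ⟶ A') (f' : A' ⟶ A'') (g : B ⟶ B')
    (g' : B' ⟶ B'') : tmul K (f ≫ f') (g ≫ g') = tmul K f g ≫ tmul K f' g' := rfl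

lemma tmul_add {A A' : C} {B B' : D} (f : A ⟶ A') (g g' : B ⟶ B') :
    tmul K f (g + g') = tmul K f g + tmul K f g' := TensorProduct.tmul_add f g g'

lemma add_tmul {A A' : C} {B B' : D} (f f' : A ⟶ A') (g : B ⟶ B') :
    tmul K (f + f') g = tmul K f g + tmul K f' g := TensorProduct.add_tmul f f' g

end TensorCat

/-! ### Bimodules `M ∈ Mod(U ⊗_K Tᵒᵖ)` -/

section Bimodule

variable {K : Type v} [Field K] {U T : Type u} [Category.{v} U] [Category.{v} T]
  [Preadditive U] [Preadditive T] [Linear K U] [Linear K T]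
  (M : Mod (TensorCat K U Tᵒᵖ))

/-- The group `M(U, T)`. -/
abbrev val (X : U) (Y : T) : Type (max u v) := M.obj.obj ⟨X, op Y⟩

/-- The left action `u • m = M(u ⊗ 1)(m)`. -/
def lact {X X' : U} (f : X ⟶ X') (Y : T) : val M X Y →+ val M X' Y :=
  act M (TensorCat.tmul K f (𝟙 (op Y)))

/-- The right action `m • t = M(1 ⊗ tᵒᵖ)(m)`. -/
def ract (X : U) {Y Y' : T} (t : Y ⟶ Y') : val M X Y' →+ val M X Y :=
  act M (TensorCat.tmul K (𝟙 X) t.op)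

@[simp] lemma lact_id (X : U) (Y : T) (m : val M X Y) : lact M (𝟙 X) Y m = m := by
  simp [lact, TensorCat.tmul_id]

@[simp] lemma ract_id (X : U) (Y : T) (m : val M X Y) : ract M X (𝟙 Y) m = m := by
  simp [ract, TensorCat.tmul_id]

@[simp] lemma lact_comp {X X' X'' : U} (f : X ⟶ X') (g : X' ⟶ X'') (Y : T) (m : val M X Y) :
    lact M (f ≫ g) Y m = lact M g Y (lact M f Y m) := by
  simp only [lact]
  rw [← act_comp, ← TensorCat.tmul_comp, Category.comp_id]

@[simp] lemma ract_comp (X : U) {Y Y' Y'' : T} (s : Y ⟶ Y') (t : Y' ⟶ Y'')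
    (m : val M X Y'') : ract M X (s ≫ t) m = ract M X s (ract M X t m) := by
  simp only [ract]
  rw [← act_comp, ← TensorCat.tmul_comp, Category.comp_id, op_comp]

@[simp] lemma lact_add {X X' : U} (f g : X ⟶ X') (Y : T) (m : val M X Y) :
    lact M (f + g) Y m = lact M f Y m + lact M g Y m := by
  simp only [lact, TensorCat.add_tmul, act_add]

@[simp] lemma ract_add (X : U) {Y Y' : T} (s t : Y ⟶ Y') (m : val M X Y') :
    ract M X (s + t) m = ract M X s m + ract M X t m := by
  simp only [ract, op_add, TensorCat.tmul_add, act_add]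

lemma lact_ract {X X' : U} (f : X ⟶ X') {Y Y' : T} (t : Y ⟶ Y') (m : val M X Y') :
    lact M f Y (ract M X t m) = ract M X' t (lact M f Y' m) := by
  simp only [lact, ract]
  rw [← act_comp, ← act_comp, ← TensorCat.tmul_comp, ← TensorCat.tmul_comp]
  simp only [Category.id_comp, Category.comp_id]

/-- The `U`-module `M_T = M(-, T)`. -/
def atT (Y : T) : Mod U :=
  mkMod (fun X => val M X Y) (fun f => lact M f Y) (fun X m => lact_id M X Y m)
    (fun f g m => lact_comp M f g Y m) (fun f g m => lact_add M f g Y m)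

/-- The `Tᵒᵖ`-module `M_U = M(U, -)`. -/
def atU (X : U) : Mod Tᵒᵖ :=
  mkMod (fun Y => val M X Y.unop) (fun t => ract M X t.unop) (fun Y m => ract_id M X Y.unop m)
    (fun s t m => ract_comp M X t.unop s.unop m)
    (fun s t m => ract_add M X s.unop t.unop m)

/-- The morphism `t̄ : M_{T'} ⟶ M_T` of `U`-modules given by `t : T ⟶ T'`. -/
def bar {Y Y' : T} (t : Y ⟶ Y') : atT M Y' ⟶ atT M Y :=
  mkHom (M := atT M Y') (N := atT M Y) (fun X => ract M X t)
    (fun f m => (lact_ract M f t m).symm)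

/-- The `T`-module `G(B) = Hom(M_(-), B)`. -/
def gObj (B : Mod U) : Mod T :=
  mkMod (fun Y => (atT M Y ⟶ B))
    (fun t =>
      { toFun := fun φ => bar M t ≫ φ
        map_zero' := comp_zero
        map_add' := fun _ _ => Preadditive.comp_add _ _ _ _ _ _ })
    (fun Y φ => hom_ext fun X m => congrArg (app φ X) (ract_id M X Y m))
    (fun s t φ => hom_ext fun X m => congrArg (app φ X) (ract_comp M X s t m))
    (fun s t φ => hom_ext fun X m =>
      (congrArg (app φ X) (ract_add M X s t m)).trans (map_add (app φ X) _ _))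

/-- The functor `G : Mod(U) ⥤ Mod(T)`. -/
def G : Mod U ⥤ Mod T where
  obj B := gObj M B
  map {B B'} η := mkHom (M := gObj M B) (N := gObj M B')
    (fun Y =>
      { toFun := fun φ => (show atT M Y ⟶ B from φ) ≫ η
        map_zero' := zero_comp
        map_add' := fun _ _ => Preadditive.add_comp _ _ _ _ _ _ })
    (fun t φ => Category.assoc (bar M t) (show atT M _ ⟶ B from φ) η)
  map_id _ := rfl
  map_comp _ _ := rfl

/-- The comma category `(Mod(T), G Mod(U))`: triples `(A, f, B)` with `f : A ⟶ G(B)`; morphisms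
are the pairs `(α, β)` with `α ≫ f' = f ≫ G(β)`. -/
abbrev CommaMod := Comma (𝟭 (Mod T)) (G M)

/-- The product `m · x = [f_T(x)]_U(m) ∈ B(U)` for `x ∈ A(T)`, `m ∈ M(U, T)`. -/
def dot {M : Mod (TensorCat K U Tᵒᵖ)} (Z : CommaMod M) {X : U} {Y : T} (m : val M X Y)
    (x : Z.left.obj.obj Y) : Z.right.obj.obj X :=
  app (show atT M Y ⟶ Z.right from app Z.hom Y x) X m

/-! ### The triangular matrix category -/

/-- The triangular matrix category `Λ = [T 0; M U]`: its objects are pairs of an object of `T`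
and an object of `U`. -/
structure Lam (M : Mod (TensorCat K U Tᵒᵖ)) where
  t : T
  u : U

/-- A morphism `[t 0; m u]` of `Λ`. -/
@[ext]
structure Lam.Hom (P Q : Lam M) where
  t : P.t ⟶ Q.t
  m : val M Q.u P.t
  u : P.u ⟶ Q.u

namespace Lam

variable {M}

/-- Composition is matrix multiplication: the corner of `b ∘ a` is `m_b • t_a + u_b • m_a`. -/
instance category : Category (Lam M) where
  Hom P Q := Lam.Hom M P Q
  id P := ⟨𝟙 P.t, 0, 𝟙 P.u⟩
  comp {P Q R} a b := ⟨a.t ≫ b.t, ract M R.u a.t b.m + lact M b.u P.t a.m, a.u ≫ b.u⟩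
  id_comp a := by apply Lam.Hom.ext <;> simp
  comp_id a := by apply Lam.Hom.ext <;> simp
  assoc a b c := by apply Lam.Hom.ext <;> simp [lact_ract, add_assoc]

@[ext] lemma hom_ext' {P Q : Lam M} {a b : P ⟶ Q} (ht : a.t = b.t) (hm : a.m = b.m)
    (hu : a.u = b.u) : a = b := Lam.Hom.ext ht hm hu

@[simp] lemma id_t (P : Lam M) : Lam.Hom.t (𝟙 P) = 𝟙 P.t := rfl
@[simp] lemma id_m (P : Lam M) : Lam.Hom.m (𝟙 P) = 0 := rfl
@[simp] lemma id_u (P : Lam M) : Lam.Hom.u (𝟙 P) = 𝟙 P.u := rfl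
@[simp] lemma comp_t {P Q R : Lam M} (a : P ⟶ Q) (b : Q ⟶ R) : (a ≫ b).t = a.t ≫ b.t := rfl
@[simp] lemma comp_m {P Q R : Lam M} (a : P ⟶ Q) (b : Q ⟶ R) :
    (a ≫ b).m = ract M R.u a.t b.m + lact M b.u P.t a.m := rfl
@[simp] lemma comp_u {P Q R : Lam M} (a : P ⟶ Q) (b : Q ⟶ R) : (a ≫ b).u = a.u ≫ b.u := rfl

/-- Morphisms of `Λ` are added entrywise. -/
instance homAdd (P Q : Lam M) : Add (P ⟶ Q) := ⟨fun a b => ⟨a.t + b.t, a.m + b.m, a.u + b.u⟩⟩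

instance homZero (P Q : Lam M) : Zero (P ⟶ Q) := ⟨⟨0, 0, 0⟩⟩

instance homNeg (P Q : Lam M) : Neg (P ⟶ Q) := ⟨fun a => ⟨-a.t, -a.m, -a.u⟩⟩

instance homGroup (P Q : Lam M) : AddCommGroup (P ⟶ Q) where
  add_assoc a b c := Lam.Hom.ext (add_assoc _ _ _) (add_assoc _ _ _) (add_assoc _ _ _)
  zero_add a := Lam.Hom.ext (zero_add _) (zero_add _) (zero_add _)
  add_zero a := Lam.Hom.ext (add_zero _) (add_zero _) (add_zero _)
  add_comm a b := Lam.Hom.ext (add_comm _ _) (add_comm _ _) (add_comm _ _)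
  neg_add_cancel a :=
    Lam.Hom.ext (neg_add_cancel _) (neg_add_cancel _) (neg_add_cancel _)
  nsmul := nsmulRec
  zsmul := zsmulRec

@[simp] lemma add_t {P Q : Lam M} (a b : P ⟶ Q) : (a + b).t = a.t + b.t := rfl
@[simp] lemma add_m {P Q : Lam M} (a b : P ⟶ Q) : (a + b).m = a.m + b.m := rfl
@[simp] lemma add_u {P Q : Lam M} (a b : P ⟶ Q) : (a + b).u = a.u + b.u := rfl

instance preadditive : Preadditive (Lam M) where
  homGroup := homGroup
  add_comp P Q R a b c := by
    ext
    · simp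
    · simp only [comp_m, add_t, add_m, ract_add, map_add]; abel
    · simp
  comp_add P Q R a b c := by
    ext
    · simp
    · simp only [comp_m, add_u, add_m, lact_add, map_add]; abel
    · simp

end Lam

variable {M}

@[simp] lemma dot_zero_left (Z : CommaMod M) {X : U} {Y : T} (x : Z.left.obj.obj Y) :
    dot Z (0 : val M X Y) x = 0 := map_zero _

@[simp] lemma dot_zero_right (Z : CommaMod M) {X : U} {Y : T} (m : val M X Y) :
    dot Z m (0 : Z.left.obj.obj Y) = 0 := by
  unfold dot; rw [map_zero]; rfl

@[simp] lemma dot_add_left (Z : CommaMod M) {X : U} {Y : T} (m n : val M X Y)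
    (x : Z.left.obj.obj Y) : dot Z (m + n) x = dot Z m x + dot Z n x := map_add _ _ _

@[simp] lemma dot_add_right (Z : CommaMod M) {X : U} {Y : T} (m : val M X Y)
    (x y : Z.left.obj.obj Y) : dot Z m (x + y) = dot Z m x + dot Z m y := by
  unfold dot; rw [map_add]; rfl

@[simp] lemma dot_lact (Z : CommaMod M) {X X' : U} (f : X ⟶ X') {Y : T} (m : val M X Y)
    (x : Z.left.obj.obj Y) : dot Z (lact M f Y m) x = act Z.right f (dot Z m x) :=
  app_act (M := atT M Y) (show atT M Y ⟶ Z.right from app Z.hom Y x) f m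

@[simp] lemma dot_ract (Z : CommaMod M) {X : U} {Y Y' : T} (t : Y ⟶ Y') (m : val M X Y')
    (x : Z.left.obj.obj Y) : dot Z (ract M X t m) x = dot Z m (act Z.left t x) := by
  have h : app Z.hom Y' (act Z.left t x) = act (gObj M Z.right) t (app Z.hom Y x) :=
    app_act Z.hom t x
  unfold dot
  rw [h]
  rfl

lemma app_dot {Z W : CommaMod M} (φ : Z ⟶ W) {X : U} {Y : T} (m : val M X Y)
    (x : Z.left.obj.obj Y) : app φ.right X (dot Z m x) = dot W m (app φ.left Y x) := by
  have h : app W.hom Y (app φ.left Y x) = app ((G M).map φ.right) Y (app Z.hom Y x) :=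
    congrArg (fun η => app η Y x) φ.w
  unfold dot
  rw [h]
  rfl

/-- The `Λ`-module `A ⨿_f B`: its value at `(T, U)` is `A(T) × B(U)`, and `[t 0; m u]` acts by
`(x, y) ↦ (A(t)(x), m · x + B(u)(y))`. -/
def FObj (Z : CommaMod M) : Mod (Lam M) :=
  mkMod (fun P => Z.left.obj.obj P.t × Z.right.obj.obj P.u)
    (fun a =>
      { toFun := fun p => (act Z.left a.t p.1, dot Z a.m p.1 + act Z.right a.u p.2)
        map_zero' := by simp
        map_add' := fun p q => by
          ext
          · simp
          · simp only [Prod.fst_add, Prod.snd_add, dot_add_right, map_add]; abel })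
    (fun P p => by simp)
    (fun a b p => by
      ext
      · simp
      · simp [add_assoc])
    (fun a b p => by
      ext
      · simp
      · simp only [AddMonoidHom.coe_mk, ZeroHom.coe_mk, Lam.add_m, Lam.add_u, dot_add_left,
          act_add, Prod.snd_add]
        abel)

variable (M) in
/-- The functor `𝔉 : (Mod(T), G Mod(U)) ⥤ Mod(Λ)`, `(A, f, B) ↦ A ⨿_f B`, `(α, β) ↦ α ⨿ β`. -/
def F : CommaMod M ⥤ Mod (Lam M) where
  obj Z := FObj Z
  map {Z W} φ := mkHom (M := FObj Z) (N := FObj W)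
    (fun P => (app φ.left P.t).prodMap (app φ.right P.u))
    (fun {P Q} a p => by
      refine Prod.ext (app_act φ.left a.t p.1) ?_
      change app φ.right Q.u (dot Z a.m p.1 + act Z.right a.u p.2) =
        dot W a.m (app φ.left P.t p.1) + act W.right a.u (app φ.right P.u p.2)
      rw [map_add, app_dot, app_act])
  map_id Z := rfl
  map_comp φ ψ := rfl

variable (M) in
/-- The objects `(A, f, B)` of the comma category with `A ∈ mod(T)` and `B ∈ mod(U)`. -/
def IsFPComma : ObjectProperty (CommaMod M) := fun Z => IsFP Z.left ∧ IsFP Z.right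

end Bimodule

end

end TriMat

namespace TriMat

noncomputable section

section FinitelyPresented

variable {C : Type u} [Category.{v} C] [Preadditive C]

/-! ### Submodules generated by elements -/

/-! Finite biproducts give zero objects in U and T, so every object (T, U) of Λ is the biproduct of
(T, 0) and (0, U). Additive functors preserve biproducts, so a Λ-module N amounts to the T-module
N(-, 0), the U-module N(0, -), and the action of the corner matrices [0 0; m 0], which is a morphism
N(-, 0) ⟶ G(N(0, -)). Thus 𝔉 is fully faithful (`faithful_F`, `full_F`) and N is isomorphic to 𝔉 of
its triple (`FObjToCommaIso`).

It remains to match finite presentation on the two sides. The module 𝔉(A, f, B) is an extension of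
A, inflated along Λ ⥤ T, by B, inflated along Λ ⥤ U; conversely N(-, 0) and N(0, -) are restrictions
of N. Finitely presented modules are closed under extensions (`IsFP.of_extension`), and these
inflations and restrictions are exact, being computed pointwise, so by `IsFP.map` only representable
modules need checking: the inflation of U(X, -) is Λ((0, X), -); the restriction of Λ((T, U), -) to
T is T(T, -); the inflation of T(Y, -) is the quotient of Λ((Y, 0), -) by the inflation of M_Y; the
restriction of Λ((T, U), -) to U is an extension of U(U, -) by M_T. The last two cases are where
finite presentation of the modules M_T enters. -/

/-- The subgroup of `M(Y)` of all elements of the submodule of `M` generated by `s`. -/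
def span (M : Mod C) (s : Set (Σ X : C, M.obj.obj X)) (Y : C) : AddSubgroup (M.obj.obj Y) :=
  AddSubgroup.closure {y | ∃ p ∈ s, ∃ f : p.1 ⟶ Y, act M f p.2 = y}

lemma act_generator_mem_span {M : Mod C} {s : Set (Σ X : C, M.obj.obj X)}
    {p : Σ X : C, M.obj.obj X} (hp : p ∈ s) {Y : C} (f : p.1 ⟶ Y) :
    act M f p.2 ∈ span M s Y :=
  AddSubgroup.subset_closure ⟨p, hp, f, rfl⟩

lemma generator_mem_span {M : Mod C} {s : Set (Σ X : C, M.obj.obj X)}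
    {p : Σ X : C, M.obj.obj X} (hp : p ∈ s) : p.2 ∈ span M s p.1 := by
  simpa using act_generator_mem_span hp (𝟙 p.1)

lemma span_induction {M : Mod C} {s : Set (Σ X : C, M.obj.obj X)} {Y : C}
    {motive : (y : M.obj.obj Y) → y ∈ span M s Y → Prop}
    (mem : ∀ p (hp : p ∈ s) (f : p.1 ⟶ Y), motive (act M f p.2) (act_generator_mem_span hp f))
    (zero : motive 0 (zero_mem _))
    (add : ∀ x y hx hy, motive x hx → motive y hy → motive (x + y) (add_mem hx hy))
    (neg : ∀ x hx, motive x hx → motive (-x) (neg_mem hx)) {y : M.obj.obj Y}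
    (hy : y ∈ span M s Y) : motive y hy := by
  induction hy using AddSubgroup.closure_induction with
  | mem x hx => obtain ⟨p, hp, f, rfl⟩ := hx; exact mem p hp f
  | zero => exact zero
  | add x y _ _ hx hy => exact add x y _ _ hx hy
  | neg x _ hx => exact neg x _ hx

lemma act_mem_span {M : Mod C} {s : Set (Σ X : C, M.obj.obj X)} {Y Z : C} (g : Y ⟶ Z)
    {y : M.obj.obj Y} (hy : y ∈ span M s Y) : act M g y ∈ span M s Z := by
  induction hy using span_induction with
  | mem p hp f => rw [← act_comp]; exact act_generator_mem_span hp _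
  | zero => rw [map_zero]; exact zero_mem _
  | add x y _ _ hx hy => rw [map_add]; exact add_mem hx hy
  | neg x _ hx => rw [map_neg]; exact neg_mem hx

lemma app_mem_span {M N : Mod C} (η : M ⟶ N) {s : Set (Σ X : C, M.obj.obj X)}
    {t : Set (Σ X : C, N.obj.obj X)} (h : ∀ p ∈ s, app η p.1 p.2 ∈ span N t p.1) {Y : C}
    {y : M.obj.obj Y} (hy : y ∈ span M s Y) : app η Y y ∈ span N t Y := by
  induction hy using span_induction with
  | mem p hp f => rw [app_act]; exact act_mem_span f (h p hp)
  | zero => rw [map_zero]; exact zero_mem _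
  | add x y _ _ hx hy => rw [map_add]; exact add_mem hx hy
  | neg x _ hx => rw [map_neg]; exact neg_mem hx

lemma app_eq_zero_of_mem_span {M N : Mod C} (η : M ⟶ N) {s : Set (Σ X : C, M.obj.obj X)}
    (h : ∀ p ∈ s, app η p.1 p.2 = 0) {Y : C} {y : M.obj.obj Y} (hy : y ∈ span M s Y) :
    app η Y y = 0 := by
  induction hy using span_induction with
  | mem p hp f => rw [app_act, h p hp, map_zero]
  | zero => exact map_zero _
  | add x y _ _ hx hy => rw [map_add, hx, hy, add_zero]
  | neg x _ hx => rw [map_neg, hx, neg_zero]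

lemma span_mono {M : Mod C} {s t : Set (Σ X : C, M.obj.obj X)} (h : s ⊆ t) {Y : C}
    {y : M.obj.obj Y} (hy : y ∈ span M s Y) : y ∈ span M t Y :=
  app_mem_span (𝟙 M) (fun _ hp => generator_mem_span (h hp)) hy

lemma exists_mem_span_of_lift {M N : Mod C} (η : M ⟶ N) {s : Set (Σ X : C, M.obj.obj X)}
    {t : Set (Σ X : C, N.obj.obj X)} (h : ∀ p ∈ t, ∃ x ∈ span M s p.1, app η p.1 x = p.2) {Y : C}
    {y : N.obj.obj Y} (hy : y ∈ span N t Y) : ∃ x ∈ span M s Y, app η Y x = y := by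
  induction hy using span_induction with
  | mem p hp f =>
    obtain ⟨x, hx, e⟩ := h p hp
    exact ⟨act M f x, act_mem_span f hx, by rw [app_act, e]⟩
  | zero => exact ⟨0, zero_mem _, map_zero _⟩
  | add x y _ _ hx hy =>
    obtain ⟨a, ha, rfl⟩ := hx
    obtain ⟨b, hb, rfl⟩ := hy
    exact ⟨a + b, add_mem ha hb, map_add _ _ _⟩
  | neg x _ hx =>
    obtain ⟨a, ha, rfl⟩ := hx
    exact ⟨-a, neg_mem ha, map_neg _ _⟩

/-- Links two views of finite generation: sets of generators, convenient for unions and images, and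
indexed families, which define maps out of free modules. -/
lemma mem_span_range {M : Mod C} {ι : Type} [Fintype ι] (x : ι → Σ X : C, M.obj.obj X) {Y : C}
    {y : M.obj.obj Y} : y ∈ span M (Set.range x) Y ↔
      ∃ f : ∀ i, (x i).1 ⟶ Y, ∑ i, act M (f i) (x i).2 = y := by
  classical
  constructor
  · intro hy
    induction hy using span_induction with
    | mem p hp f =>
      obtain ⟨i, rfl⟩ := hp
      refine ⟨Pi.single i f, (Finset.sum_eq_single i ?_ ?_).trans ?_⟩
      · intro j _ hj
        rw [Pi.single_eq_of_ne hj, act_zero]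
      · simp
      · rw [Pi.single_eq_same]
    | zero => exact ⟨0, by simp⟩
    | add x y _ _ hx hy =>
      obtain ⟨a, rfl⟩ := hx
      obtain ⟨b, rfl⟩ := hy
      exact ⟨a + b, by simp [Finset.sum_add_distrib]⟩
    | neg x _ hx =>
      obtain ⟨a, rfl⟩ := hx
      exact ⟨-a, by simp [act, Functor.map_neg]⟩
  · rintro ⟨f, rfl⟩
    exact sum_mem fun i _ => act_generator_mem_span (Set.mem_range_self i) _

/-- The family `S` of subsets of `M` contains finitely many elements which generate all of it. -/
def FGOn (M : Mod C) (S : ∀ X : C, Set (M.obj.obj X)) : Prop :=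
  ∃ s : Set (Σ X : C, M.obj.obj X), s.Finite ∧ (∀ p ∈ s, p.2 ∈ S p.1) ∧
    ∀ Y, ∀ y ∈ S Y, y ∈ span M s Y

/-- The kernel of a morphism of modules, as a family of subsets. -/
def kerSet {M N : Mod C} (η : M ⟶ N) (X : C) : Set (M.obj.obj X) := {x | app η X x = 0}

lemma isFG_iff {M : Mod C} :
    IsFG M ↔ ∃ s : Set (Σ X : C, M.obj.obj X), s.Finite ∧ ∀ Y (y : M.obj.obj Y), y ∈ span M s Y := by
  constructor
  · rintro ⟨n, X, x, h⟩
    refine ⟨Set.range fun i => ⟨X i, x i⟩, Set.finite_range _, fun Y y => ?_⟩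
    obtain ⟨f, hf⟩ := h Y y
    exact (mem_span_range _).2 ⟨f, hf.symm⟩
  · rintro ⟨s, hs, h⟩
    obtain ⟨n, x, _, rfl⟩ := hs.fin_param
    refine ⟨n, fun i => (x i).1, fun i => (x i).2, fun Y y => ?_⟩
    obtain ⟨f, hf⟩ := (mem_span_range _).1 (h Y y)
    exact ⟨f, hf.symm⟩

lemma IsFG.of_surjective {M N : Mod C} (η : M ⟶ N) (h : ∀ X, Function.Surjective (app η X))
    (hM : IsFG M) : IsFG N := by
  obtain ⟨s, hs, hM⟩ := isFG_iff.1 hM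
  refine isFG_iff.2 ⟨(fun p => ⟨p.1, app η p.1 p.2⟩) '' s, hs.image _, fun Y y => ?_⟩
  obtain ⟨x, rfl⟩ := h Y y
  exact app_mem_span η (fun p hp => generator_mem_span (Set.mem_image_of_mem _ hp)) (hM Y x)

lemma FGOn.ker_of_exact {L M N : Mod C} (ι : L ⟶ M) (η : M ⟶ N)
    (h : ∀ X, Function.Exact (app ι X) (app η X)) (hL : IsFG L) : FGOn M (kerSet η) := by
  obtain ⟨s, hs, hL⟩ := isFG_iff.1 hL
  refine ⟨(fun p => ⟨p.1, app ι p.1 p.2⟩) '' s, hs.image _, ?_, fun Y y hy => ?_⟩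
  · rintro _ ⟨p, _, rfl⟩
    exact (h _ _).2 ⟨_, rfl⟩
  · obtain ⟨x, rfl⟩ := (h Y y).1 hy
    exact app_mem_span ι (fun p hp => generator_mem_span (Set.mem_image_of_mem _ hp)) (hL Y x)

lemma FGOn.ker_of_injective {M N : Mod C} (η : M ⟶ N)
    (h : ∀ X, Function.Injective (app η X)) : FGOn M (kerSet η) := by
  refine ⟨∅, Set.finite_empty, by simp, fun Y y hy => ?_⟩
  rw [h Y ((show app η Y y = 0 from hy).trans (map_zero (app η Y)).symm)]
  exact zero_mem _

/-- Generators of ker π, together with lifts along π of generators of ker η, generate the kernel of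
the composite. -/
lemma FGOn.ker_comp {L M N : Mod C} (π : L ⟶ M) (η : M ⟶ N)
    (hs : ∀ X, Function.Surjective (app π X)) (hπ : FGOn L (kerSet π))
    (hη : FGOn M (kerSet η)) : FGOn L (kerSet (π ≫ η)) := by
  obtain ⟨s, hs1, hs2, hs3⟩ := hπ
  obtain ⟨t, ht1, ht2, ht3⟩ := hη
  have key : ∀ p : Σ X : C, M.obj.obj X, ∃ x, app π p.1 x = p.2 := fun p => hs _ _
  choose c hc using key
  refine ⟨s ∪ (fun p => ⟨p.1, c p⟩) '' t, hs1.union (ht1.image _), ?_, fun Y y hy => ?_⟩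
  · rintro _ (hp | ⟨p, hp, rfl⟩)
    · exact (congrArg (app η _) (hs2 _ hp)).trans (map_zero _)
    · exact (congrArg (app η _) (hc p)).trans (ht2 _ hp)
  · obtain ⟨x, hx, e⟩ := exists_mem_span_of_lift π (s := s ∪ (fun p => ⟨p.1, c p⟩) '' t) (t := t)
      (fun p hp => ⟨c p, generator_mem_span (p := ⟨p.1, c p⟩) (Or.inr ⟨p, hp, rfl⟩), hc p⟩)
      (ht3 Y (app π Y y) hy)
    have : y - x ∈ span L s Y := hs3 Y _ (by simp [kerSet, e])
    simpa using add_mem (span_mono Set.subset_union_left this) hx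

/-! ### Epimorphisms, products and representable modules -/

lemma epi_of_surjective {M N : Mod C} (η : M ⟶ N) (h : ∀ X, Function.Surjective (app η X)) :
    Epi η :=
  ⟨fun a b e => hom_ext fun X y => by
    obtain ⟨x, rfl⟩ := h X y
    exact congrArg (fun θ => app θ X x) e⟩

/-- The cokernel of a morphism of modules. -/
def coker {M N : Mod C} (η : M ⟶ N) : Mod C :=
  mkMod (fun X => N.obj.obj X ⧸ (app η X).range)
    (fun {X Y} f => QuotientAddGroup.map _ _ (act N f) (by
      rintro _ ⟨x, rfl⟩
      exact ⟨act M f x, app_act η f x⟩))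
    (fun X x => by
      induction x using QuotientAddGroup.induction_on with
      | H x => simp)
    (fun f g x => by
      induction x using QuotientAddGroup.induction_on with
      | H x => simp)
    (fun f g x => by
      induction x using QuotientAddGroup.induction_on with
      | H x => simp)

/-- The quotient map to the cokernel is killed by η, hence zero. This reconciles `Projective`, which
speaks of epimorphisms, with presentations, which are exact at each object. -/
lemma surjective_of_epi {M N : Mod C} (η : M ⟶ N) [Epi η] (X : C) :
    Function.Surjective (app η X) := by
  let π : N ⟶ coker η := mkHom (M := N) (N := coker η)
    (fun X => QuotientAddGroup.mk' (app η X).range) (fun f x => rfl)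
  have h : π = 0 := by
    rw [← cancel_epi η, comp_zero]
    exact hom_ext fun X x => (QuotientAddGroup.eq_zero_iff _).2 ⟨x, rfl⟩
  intro y
  have : (QuotientAddGroup.mk' (app η X).range) y = 0 := congrArg (fun θ => app θ X y) h
  exact (QuotientAddGroup.eq_zero_iff _).1 this

/-- The product of a family of modules. -/
def prodMod {ι : Type} (N : ι → Mod C) : Mod C :=
  mkMod (fun X => ∀ i, (N i).obj.obj X)
    (fun f => AddMonoidHom.mk' (fun x i => act (N i) f (x i))
      (fun _ _ => funext fun _ => map_add _ _ _))
    (fun _ _ => funext fun _ => act_id _ _ _)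
    (fun _ _ _ => funext fun _ => act_comp _ _ _ _)
    (fun _ _ _ => funext fun _ => act_add _ _ _ _)

/-- The projections of a product of modules. -/
def prodMod.π {ι : Type} (N : ι → Mod C) (i : ι) : prodMod N ⟶ N i :=
  mkHom (M := prodMod N) (N := N i) (fun X => Pi.evalAddMonoidHom (fun i => (N i).obj.obj X) i)
    (fun _ _ => rfl)

/-- The injections into a product of modules. -/
def prodMod.ι {ι : Type} [DecidableEq ι] (N : ι → Mod C) (i : ι) : N i ⟶ prodMod N :=
  mkHom (M := N i) (N := prodMod N) (fun X => AddMonoidHom.single (fun i => (N i).obj.obj X) i)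
    (fun {_ _} f x => funext fun j =>
      (Pi.apply_single (fun k => act (N k) f) (fun _ => map_zero _) i x j).symm)

/-- The product of a family of morphisms of modules. -/
def prodMod.map {ι : Type} {M N : ι → Mod C} (η : ∀ i, M i ⟶ N i) : prodMod M ⟶ prodMod N :=
  mkHom (M := prodMod M) (N := prodMod N)
    (fun X => AddMonoidHom.mk' (fun x i => app (η i) X (x i))
      (fun _ _ => funext fun _ => map_add _ _ _))
    (fun _ _ => funext fun _ => app_act _ _ _)

lemma app_sum {ι : Type} {M N : Mod C} (s : Finset ι) (η : ι → (M ⟶ N)) (X : C)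
    (x : M.obj.obj X) : app (∑ i ∈ s, η i) X x = ∑ i ∈ s, app (η i) X x :=
  map_sum (AddMonoidHom.mk' (fun θ : M ⟶ N => app θ X x) (fun _ _ => rfl)) η s

lemma prodMod.sum_single {ι : Type} [Fintype ι] [DecidableEq ι] (N : ι → Mod C) (X : C)
    (x : (prodMod N).obj.obj X) :
    ∑ i, app (prodMod.ι N i) X ((show ∀ i, (N i).obj.obj X from x) i) = x :=
  Finset.univ_sum_single (show ∀ i, (N i).obj.obj X from x)

lemma prodMod.ι_π_self {ι : Type} [DecidableEq ι] (N : ι → Mod C) (i : ι) :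
    prodMod.ι N i ≫ prodMod.π N i = 𝟙 (N i) :=
  hom_ext fun X x => Pi.single_eq_same (M := fun i => (N i).obj.obj X) i x

lemma prodMod.ι_π_of_ne {ι : Type} [DecidableEq ι] (N : ι → Mod C) {i j : ι} (h : j ≠ i) :
    prodMod.ι N i ≫ prodMod.π N j = 0 :=
  hom_ext fun X x => Pi.single_eq_of_ne (M := fun i => (N i).obj.obj X) h x

lemma prodMod.total {ι : Type} [Fintype ι] [DecidableEq ι] (N : ι → Mod C) :
    ∑ i, prodMod.π N i ≫ prodMod.ι N i = 𝟙 (prodMod N) :=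
  hom_ext fun X x => by
    rw [app_sum]
    exact prodMod.sum_single N X x

lemma projective_prodMod {ι : Type} [Fintype ι] {N : ι → Mod C} (h : ∀ i, Projective (N i)) :
    Projective (prodMod N) := by
  classical
  refine ⟨fun {E X} f e _ => ?_⟩
  -- Lift on each factor, then reassemble using the decomposition of the identity of the product.
  refine ⟨∑ i, prodMod.π N i ≫ Projective.factorThru (prodMod.ι N i ≫ f) e, ?_⟩
  calc _ = (∑ i, prodMod.π N i ≫ prodMod.ι N i) ≫ f := by
        simp [Preadditive.sum_comp]
    _ = f := by rw [prodMod.total, Category.id_comp]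

lemma isFG_prodMod {ι : Type} [Fintype ι] {N : ι → Mod C} (h : ∀ i, IsFG (N i)) :
    IsFG (prodMod N) := by
  classical
  choose s hs hN using fun i => isFG_iff.1 (h i)
  let r : Set (Σ X : C, (prodMod N).obj.obj X) :=
    ⋃ i, (fun p => ⟨p.1, app (prodMod.ι N i) p.1 p.2⟩) '' s i
  refine isFG_iff.2 ⟨r, Set.finite_iUnion fun i => (hs i).image _, fun Y y => ?_⟩
  rw [← prodMod.sum_single N Y y]
  refine sum_mem fun i _ => app_mem_span (prodMod.ι N i) (fun p hp => ?_) (hN i Y _)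
  exact generator_mem_span (s := r) (p := ⟨p.1, app (prodMod.ι N i) p.1 p.2⟩)
    (Set.mem_iUnion.2 ⟨i, p, hp, rfl⟩)

lemma isFP_prodMod {ι : Type} [Fintype ι] {N : ι → Mod C} (h : ∀ i, IsFP (N i)) :
    IsFP (prodMod N) := by
  choose P₁ P₀ d p h1 h2 h3 h4 h5 using h
  refine ⟨prodMod P₁, prodMod P₀, prodMod.map d, prodMod.map p, isFG_prodMod h1,
    projective_prodMod h2, isFG_prodMod h3, projective_prodMod h4, fun X => ⟨fun y => ?_, fun y => ?_⟩⟩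
  · constructor
    · intro hy
      choose x hx using fun i => ((h5 i X).1 _).1 (congrFun hy i)
      exact ⟨x, funext hx⟩
    · rintro ⟨x, rfl⟩
      exact funext fun i => ((h5 i X).1 _).2 ⟨_, rfl⟩
  · choose x hx using fun i => (h5 i X).2 ((show ∀ i, (N i).obj.obj X from y) i)
    exact ⟨x, funext hx⟩

/-- The representable module `C(X, -)`. -/
def rep (X : C) : Mod C :=
  mkMod (fun Y => ULift.{u} (X ⟶ Y))
    (fun f => AddMonoidHom.mk' (fun a => ⟨a.down ≫ f⟩)
      (fun _ _ => congrArg ULift.up (Preadditive.add_comp _ _ _ _ _ _)))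
    (fun _ _ => congrArg ULift.up (Category.comp_id _))
    (fun _ _ _ => congrArg ULift.up (Category.assoc _ _ _).symm)
    (fun _ _ _ => congrArg ULift.up (Preadditive.comp_add _ _ _ _ _ _))

/-- The morphism `C(X, -) ⟶ M` given by an element of `M(X)`. -/
def repHom {M : Mod C} {X : C} (x : M.obj.obj X) : rep X ⟶ M :=
  mkHom (M := rep X) (N := M)
    (fun _ => AddMonoidHom.mk' (fun a => act M (ULift.down a) x) (fun _ _ => act_add _ _ _ _))
    (fun _ _ => act_comp _ _ _ _)

/-- The element `1_X` of `C(X, X)`. -/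
def repId (X : C) : (rep X).obj.obj X := (ULift.up (𝟙 X) : ULift.{u} (X ⟶ X))

lemma act_repId {X Y : C} (a : (rep X).obj.obj Y) : act (rep X) (ULift.down a) (repId X) = a :=
  congrArg ULift.up (Category.id_comp _)

lemma app_repHom_repId {M : Mod C} {X : C} (x : M.obj.obj X) :
    app (repHom x) X (repId X) = x :=
  act_id M X x

lemma rep_hom_ext {M : Mod C} {X : C} {η θ : rep X ⟶ M}
    (h : app η X (repId X) = app θ X (repId X)) : η = θ :=
  hom_ext fun Y a => by rw [← act_repId a, app_act, app_act, h]

lemma isFG_rep (X : C) : IsFG (rep X) :=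
  isFG_iff.2 ⟨{⟨X, repId X⟩}, Set.finite_singleton _, fun Y a => by
    rw [← act_repId a]
    exact act_generator_mem_span (p := ⟨X, repId X⟩) (Set.mem_singleton _) _⟩

/-- By the Yoneda lemma, lifting a morphism out of C(X, -) means lifting one element along a
pointwise surjection. -/
lemma projective_rep (X : C) : Projective (rep X) := by
  refine ⟨fun {E N} f e _ => ?_⟩
  obtain ⟨x, hx⟩ := surjective_of_epi e X (app f X (repId X))
  exact ⟨repHom x, rep_hom_ext (by rw [app_comp, app_repHom_repId, hx])⟩

/-- The module `C(X₁, -) × ⋯ × C(Xₙ, -)`. -/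
def free {n : ℕ} (X : Fin n → C) : Mod C := prodMod fun i => rep (X i)

/-- The morphism from a free module given by elements `xᵢ ∈ M(Xᵢ)`. -/
def freeHom {M : Mod C} {n : ℕ} {X : Fin n → C} (x : ∀ i, M.obj.obj (X i)) : free X ⟶ M :=
  ∑ i, prodMod.π (fun i => rep (X i)) i ≫ repHom (x i)

lemma app_freeHom {M : Mod C} {n : ℕ} {X : Fin n → C} (x : ∀ i, M.obj.obj (X i)) (Y : C)
    (f : ∀ i, ULift.{u} (X i ⟶ Y)) :
    app (freeHom x) Y f = ∑ i, act M (f i).down (x i) :=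
  app_sum _ _ _ _

lemma isFG_free {n : ℕ} (X : Fin n → C) : IsFG (free X) := isFG_prodMod fun _ => isFG_rep _

lemma projective_free {n : ℕ} (X : Fin n → C) : Projective (free X) :=
  projective_prodMod fun _ => projective_rep _

lemma mem_span_iff_freeHom {M : Mod C} {n : ℕ} (x : Fin n → Σ X : C, M.obj.obj X) {Y : C}
    {y : M.obj.obj Y} : y ∈ span M (Set.range x) Y ↔
      ∃ z, app (freeHom fun i => (x i).2) Y z = y := by
  rw [mem_span_range]
  constructor
  · rintro ⟨f, rfl⟩
    exact ⟨_, app_freeHom _ Y fun i => ⟨f i⟩⟩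
  · rintro ⟨z, rfl⟩
    exact ⟨fun i => ((show ∀ i, ULift.{u} ((x i).1 ⟶ Y) from z) i).down,
      (app_freeHom (fun i => (x i).2) Y z).symm⟩

/-! ### Finitely presented modules -/

/-- Finitely many generators of the kernel define a free module mapping onto it, which serves as the
first term of a presentation. -/
lemma isFP_of_projective_cover {P M : Mod C} (hP : IsFG P) (hP' : Projective P) (p : P ⟶ M)
    (hp : ∀ X, Function.Surjective (app p X)) (hk : FGOn P (kerSet p)) : IsFP M := by
  obtain ⟨s, hs, hs1, hs2⟩ := hk
  obtain ⟨n, x, _, rfl⟩ := hs.fin_param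
  refine ⟨free fun i => (x i).1, P, freeHom fun i => (x i).2, p, isFG_free _, projective_free _,
    hP, hP', fun X => ⟨fun y => ⟨fun hy => (mem_span_iff_freeHom x).1 (hs2 X y hy), ?_⟩, hp X⟩⟩
  exact fun hy => app_eq_zero_of_mem_span p hs1 ((mem_span_iff_freeHom x).2 hy)

lemma IsFP.isFG {M : Mod C} (h : IsFP M) : IsFG M := by
  obtain ⟨_, _, _, p, _, _, h3, _, h5⟩ := h
  exact h3.of_surjective p fun X => (h5 X).2

/-- A Schanuel-type argument: finite generation of the relations does not depend on the chosen
finitely generated cover. It lets any presentation be replaced by a convenient one. -/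
lemma IsFP.fgOn_ker {M N : Mod C} (hM : IsFP M) (hN : IsFG N) (η : N ⟶ M)
    (hη : ∀ X, Function.Surjective (app η X)) : FGOn N (kerSet η) := by
  obtain ⟨P₁, P₀, d, p, h1, _, _, h4, h5⟩ := hM
  obtain ⟨s, hs, hN⟩ := isFG_iff.1 hN
  obtain ⟨r, hr, hP₁⟩ := isFG_iff.1 h1
  have := epi_of_surjective η hη
  let q : P₀ ⟶ N := Projective.factorThru p η
  have hq : ∀ X x, app η X (app q X x) = app p X x := fun X x =>
    congrArg (fun θ => app θ X x) (Projective.factorThru_comp p η)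
  have key : ∀ n : Σ X : C, N.obj.obj X, ∃ x, app p n.1 x = app η n.1 n.2 :=
    fun n => (h5 n.1).2 _
  choose a ha using key
  -- The first family corrects each generator of N by an element of the image of q to land in ker η;
  -- the second is the image under q of the relations of the given presentation.
  let t : Set (Σ X : C, N.obj.obj X) := (fun n => ⟨n.1, n.2 - app q n.1 (a n)⟩) '' s ∪
    (fun x => ⟨x.1, app q x.1 (app d x.1 x.2)⟩) '' r
  have htk : ∀ n ∈ t, n.2 ∈ kerSet η n.1 := by
    rintro _ (⟨n, hn, rfl⟩ | ⟨x, hx, rfl⟩)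
    · simp [kerSet, hq, ha]
    · simpa [kerSet, hq] using ((h5 _).1 _).2 ⟨_, rfl⟩
  -- Modulo the span of t, every element of N comes from P₀; an element of ker η then comes from ker
  -- p, that is, from P₁.
  have hsub : ∀ Y (y : N.obj.obj Y), ∃ x, y - app q Y x ∈ span N t Y := by
    intro Y y
    induction hN Y y using span_induction with
    | mem n hn f =>
      refine ⟨act P₀ f (a n), ?_⟩
      rw [app_act, ← map_sub]
      exact act_generator_mem_span (p := ⟨n.1, n.2 - app q n.1 (a n)⟩) (Or.inl ⟨n, hn, rfl⟩) f
    | zero => exact ⟨0, by simp⟩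
    | add y z _ _ hy hz =>
      obtain ⟨b, hb⟩ := hy
      obtain ⟨c, hc⟩ := hz
      exact ⟨b + c, by rw [map_add, add_sub_add_comm]; exact add_mem hb hc⟩
    | neg y _ hy =>
      obtain ⟨b, hb⟩ := hy
      exact ⟨-b, by rw [map_neg, ← neg_sub']; exact neg_mem hb⟩
  refine ⟨t, (hs.image _).union (hr.image _), htk, fun Y y hy => ?_⟩
  obtain ⟨x, hx⟩ := hsub Y y
  have hpx : app p Y x = 0 := by
    have := app_eq_zero_of_mem_span η htk hx
    rw [map_sub, show app η Y y = 0 from hy, hq, zero_sub, neg_eq_zero] at this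
    exact this
  obtain ⟨z, rfl⟩ := ((h5 Y).1 x).1 hpx
  have hz : app q Y (app d Y z) ∈ span N t Y :=
    app_mem_span (d ≫ q) (fun x hx => generator_mem_span
      (p := ⟨x.1, app q x.1 (app d x.1 x.2)⟩) (Or.inr ⟨x, hx, rfl⟩)) (hP₁ Y z)
  simpa using add_mem hx hz

lemma IsFP.of_surjective {M N : Mod C} (hN : IsFP N) (η : N ⟶ M)
    (hη : ∀ X, Function.Surjective (app η X)) (hk : FGOn N (kerSet η)) : IsFP M := by
  have hN' := hN
  obtain ⟨_, P₀, _, p, _, _, h3, h4, h5⟩ := hN'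
  exact isFP_of_projective_cover h3 h4 (p ≫ η) (fun X => (hη X).comp (h5 X).2)
    (FGOn.ker_comp p η (fun X => (h5 X).2) (hN.fgOn_ker h3 p fun X => (h5 X).2) hk)

lemma IsFP.of_bijective {M N : Mod C} (hN : IsFP N) (η : N ⟶ M)
    (hη : ∀ X, Function.Bijective (app η X)) : IsFP M :=
  hN.of_surjective η (fun X => (hη X).2) (.ker_of_injective η fun X => (hη X).1)

lemma isFP_rep (X : C) : IsFP (rep X) :=
  isFP_of_projective_cover (isFG_rep X) (projective_rep X) (𝟙 _) (fun _ y => ⟨y, rfl⟩)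
    (.ker_of_injective _ fun _ _ _ h => h)

lemma IsFG.exists_free {M : Mod C} (h : IsFG M) : ∃ (n : ℕ) (X : Fin n → C) (π : free X ⟶ M),
    ∀ Y, Function.Surjective (app π Y) := by
  obtain ⟨s, hs, h⟩ := isFG_iff.1 h
  obtain ⟨n, x, _, rfl⟩ := hs.fin_param
  exact ⟨n, fun i => (x i).1, freeHom fun i => (x i).2,
    fun Y y => (mem_span_iff_freeHom x).1 (h Y y)⟩

/-- For a free cover π of N, the kernel K of the composite to M is finitely generated and maps onto
L with kernel ker π. Finite presentation of L then makes ker π finitely generated. -/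
lemma IsFP.of_extension {L M N : Mod C} (hL : IsFP L) (hM : IsFP M) (ι : L ⟶ N) (p : N ⟶ M)
    (hι : ∀ X, Function.Injective (app ι X)) (he : ∀ X, Function.Exact (app ι X) (app p X))
    (hp : ∀ X, Function.Surjective (app p X)) : IsFP N := by
  have hN : IsFG N := by
    obtain ⟨s, hs, hL⟩ := isFG_iff.1 hL.isFG
    obtain ⟨t, ht, hM⟩ := isFG_iff.1 hM.isFG
    choose c hc using fun m : Σ X : C, M.obj.obj X => hp m.1 m.2
    let r : Set (Σ X : C, N.obj.obj X) :=
      (fun l => ⟨l.1, app ι l.1 l.2⟩) '' s ∪ (fun m => ⟨m.1, c m⟩) '' t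
    refine isFG_iff.2 ⟨r, (hs.image _).union (ht.image _), fun Y y => ?_⟩
    obtain ⟨x, hx, e⟩ := exists_mem_span_of_lift p (s := r)
      (fun m hm => ⟨c m, generator_mem_span (p := ⟨m.1, c m⟩) (Or.inr ⟨m, hm, rfl⟩), hc m⟩)
      (hM Y (app p Y y))
    obtain ⟨l, hl⟩ := (he Y (y - x)).1 (by rw [map_sub, e, sub_self])
    have : app ι Y l ∈ span N r Y := app_mem_span ι (fun l hl =>
      generator_mem_span (p := ⟨l.1, app ι l.1 l.2⟩) (Or.inl ⟨l, hl, rfl⟩)) (hL Y l)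
    rw [hl] at this
    simpa using add_mem this hx
  obtain ⟨n, X, π, hπ⟩ := hN.exists_free
  obtain ⟨s, hs, hs1, hs2⟩ := hM.fgOn_ker (isFG_free X) (π ≫ p) fun Y => (hp Y).comp (hπ Y)
  obtain ⟨m, x, _, rfl⟩ := hs.fin_param
  -- Generators of K are sent by π into the image of L. The free module on them gets a map φ onto K
  -- and a map ψ to L, compatible with π and ι.
  choose l hl using fun i => (he _ (app π _ (x i).2)).1 (hs1 _ (Set.mem_range_self i))
  let φ : (free fun i => (x i).1) ⟶ free X := freeHom fun i => (x i).2
  let ψ : (free fun i => (x i).1) ⟶ L := freeHom l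
  have hφψ : ∀ Y z, app ι Y (app ψ Y z) = app π Y (app φ Y z) := by
    intro Y z
    have h1 := app_freeHom l Y z
    have h2 := app_freeHom (M := free X) (fun i => (x i).2) Y z
    rw [h1, h2, map_sum, map_sum]
    exact Finset.sum_congr rfl fun i _ => by rw [app_act, app_act, hl]
  have hφ : ∀ Y y, app p Y (app π Y y) = 0 → ∃ z, app φ Y z = y := fun Y y hy =>
    (mem_span_iff_freeHom x).1 (hs2 Y y hy)
  have hψ : ∀ Y, Function.Surjective (app ψ Y) := by
    intro Y a
    obtain ⟨y, hy⟩ := hπ Y (app ι Y a)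
    obtain ⟨z, rfl⟩ := hφ Y y (by rw [hy]; exact (he Y _).2 ⟨a, rfl⟩)
    exact ⟨z, hι Y (by rw [hφψ, hy])⟩
  obtain ⟨t, ht, ht1, ht2⟩ := hL.fgOn_ker (isFG_free _) ψ hψ
  -- As ι is injective, φ carries ker ψ onto ker π, so the images under φ of generators of ker ψ
  -- suffice.
  refine isFP_of_projective_cover (isFG_free X) (projective_free X) π hπ
    ⟨(fun q => ⟨q.1, app φ q.1 q.2⟩) '' t, ht.image _, ?_, fun Y y hy => ?_⟩
  · rintro _ ⟨q, hq, rfl⟩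
    exact (hφψ _ _).symm.trans ((congrArg _ (ht1 q hq)).trans (map_zero _))
  · obtain ⟨z, rfl⟩ := hφ Y y (by rw [show app π Y y = 0 from hy, map_zero])
    have hz : app ψ Y z = 0 := hι Y (by rw [hφψ, map_zero]; exact hy)
    exact app_mem_span φ (fun q hq => generator_mem_span (Set.mem_image_of_mem _ hq)) (ht2 Y z hz)

end FinitelyPresented

/-! ### Exact functors and finite presentation -/

section ExactFunctors

variable {C : Type u} [Category.{v} C] [Preadditive C]

/-- Replaces arbitrary finitely generated projectives by finite products of representables, on which
an additive functor is controlled by its values at representables. -/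
lemma IsFP.exists_free_presentation {N : Mod C} (h : IsFP N) :
    ∃ (m n : ℕ) (Y : Fin m → C) (X : Fin n → C) (d : free Y ⟶ free X) (p : free X ⟶ N),
      (∀ Z, Function.Exact (app d Z) (app p Z)) ∧ ∀ Z, Function.Surjective (app p Z) := by
  obtain ⟨n, X, p, hp⟩ := h.isFG.exists_free
  obtain ⟨s, hs, hs1, hs2⟩ := h.fgOn_ker (isFG_free X) p hp
  obtain ⟨m, y, _, rfl⟩ := hs.fin_param
  refine ⟨m, n, fun i => (y i).1, X, freeHom fun i => (y i).2, p, fun Z x => ⟨fun hx =>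
    (mem_span_iff_freeHom y).1 (hs2 Z x hx), ?_⟩, hp⟩
  exact fun hx => app_eq_zero_of_mem_span p hs1 ((mem_span_iff_freeHom y).2 hx)

/-- The kernel of the retraction r is the image of 1 - r ≫ s, hence a quotient of N and finitely
generated. -/
lemma IsFP.of_retract {M N : Mod C} (hN : IsFP N) (s : M ⟶ N) (r : N ⟶ M) (h : s ≫ r = 𝟙 M) :
    IsFP M := by
  have h' : ∀ X x, app r X (app s X x) = x := fun X x => congrArg (fun θ => app θ X x) h
  refine hN.of_surjective r (fun X x => ⟨_, h' X x⟩)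
    (.ker_of_exact (𝟙 N - r ≫ s) r (fun X y => ⟨fun hy => ⟨y, ?_⟩, ?_⟩) hN.isFG)
  · change y - app s X (app r X y) = y
    rw [hy, map_zero, sub_zero]
  · rintro ⟨x, rfl⟩
    change app r X (x - app s X (app r X x)) = 0
    rw [map_sub, h', sub_self]

lemma sum_map_comp_map {A B : Type*} [Category* A] [Category* B] [Preadditive A] [Preadditive B]
    (R : A ⥤ B) [R.Additive] {ι : Type*} [Fintype ι] {P : A} {N : ι → A} (p : ∀ i, P ⟶ N i)
    (q : ∀ i, N i ⟶ P) (h : ∑ i, p i ≫ q i = 𝟙 P) :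
    ∑ i, R.map (p i) ≫ R.map (q i) = 𝟙 (R.obj P) := by
  simp_rw [← R.map_comp]
  rw [← R.map_sum, h, R.map_id]

/-- An exact functor between module categories preserves finitely presented modules as soon as
it sends representable modules to finitely presented ones. -/
lemma IsFP.map {D : Type*} [Category* D] [Preadditive D] (R : Mod D ⥤ Mod C) [R.Additive]
    (hs : ∀ {M N : Mod D} (η : M ⟶ N), (∀ X, Function.Surjective (app η X)) →
      ∀ X, Function.Surjective (app (R.map η) X))
    (he : ∀ {L M N : Mod D} (ι : L ⟶ M) (η : M ⟶ N),
      (∀ X, Function.Exact (app ι X) (app η X)) →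
        ∀ X, Function.Exact (app (R.map ι) X) (app (R.map η) X))
    (hrep : ∀ X : D, IsFP (R.obj (rep X))) {N : Mod D} (hN : IsFP N) : IsFP (R.obj N) := by
  have hfree : ∀ {n : ℕ} (X : Fin n → D), IsFP (R.obj (prodMod fun i => rep (X i))) := by
    intro n X
    have hP : IsFP (prodMod fun i => R.obj (rep (X i))) := isFP_prodMod fun i => hrep (X i)
    -- The image under R of a free module need not be literally the product of the images, but
    -- additivity makes it a retract of that product.
    refine hP.of_retract
      (∑ i, R.map (prodMod.π (fun i => rep (X i)) i) ≫ prodMod.ι (fun i => R.obj (rep (X i))) i)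
      (∑ i, prodMod.π (fun i => R.obj (rep (X i))) i ≫ R.map (prodMod.ι (fun i => rep (X i)) i)) ?_
    have hι : ∀ i, prodMod.ι (fun i => R.obj (rep (X i))) i ≫
        (∑ j, prodMod.π (fun i => R.obj (rep (X i))) j ≫
          R.map (prodMod.ι (fun i => rep (X i)) j)) = R.map (prodMod.ι (fun i => rep (X i)) i) := by
      intro i
      rw [Preadditive.comp_sum, Finset.sum_eq_single i]
      · rw [← Category.assoc, prodMod.ι_π_self, Category.id_comp]
      · intro j _ hj
        rw [← Category.assoc, prodMod.ι_π_of_ne _ hj, zero_comp]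
      · simp
    rw [Preadditive.sum_comp]
    simp only [Category.assoc, hι]
    exact sum_map_comp_map R _ _ (prodMod.total fun i => rep (X i))
  obtain ⟨m, n, Y, X, d, p, h1, h2⟩ := hN.exists_free_presentation
  exact (hfree X).of_surjective (R.map p) (hs p h2)
    (.ker_of_exact (R.map d) (R.map p) (he d p h1) (hfree Y).isFG)

end ExactFunctors

/-- Restriction of additive functors to abelian groups along an additive functor. -/
def res {C D : Type*} [Category* C] [Category* D] [Preadditive C] [Preadditive D] (j : C ⥤ D)
    [j.Additive] : (D ⥤+ AddCommGrpCat.{v}) ⥤ (C ⥤+ AddCommGrpCat.{v}) where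
  obj N := AdditiveFunctor.of (j ⋙ N.obj)
  map η := ObjectProperty.homMk (Functor.whiskerLeft j η.hom)
  map_id _ := rfl
  map_comp _ _ := rfl

instance {C D : Type*} [Category* C] [Category* D] [Preadditive C] [Preadditive D] (j : C ⥤ D)
    [j.Additive] : (res.{v} j).Additive where
  map_add := rfl

/-! ### Restriction and inflation between Λ and its diagonal categories -/

section Bimodule

variable {K : Type v} [Field K] {U T : Type u} [Category.{v} U] [Category.{v} T]
  [Preadditive U] [Preadditive T] [Linear K U] [Linear K T]
  {M : Mod (TensorCat K U Tᵒᵖ)}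

lemma ract_zero (X : U) {Y Y' : T} (m : val M X Y') : ract M X (0 : Y ⟶ Y') m = 0 := by
  simpa using ract_add M X (0 : Y ⟶ Y') 0 m

lemma lact_zero {X X' : U} (Y : T) (m : val M X Y) : lact M (0 : X ⟶ X') Y m = 0 := by
  simpa using lact_add M (0 : X ⟶ X') 0 Y m

/-- The identity of a zero object is the zero morphism, so it acts on M both as the identity and as
zero. -/
lemma val_eq_zero_of_isZero_left {z : U} (hz : IsZero z) {Y : T} (m : val M z Y) : m = 0 := by
  rw [← lact_id M z Y m, hz.eq_of_src (𝟙 z) 0, lact_zero]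

lemma val_eq_zero_of_isZero_right {z : T} (hz : IsZero z) {X : U} (m : val M X z) : m = 0 := by
  rw [← ract_id M X z m, hz.eq_of_src (𝟙 z) 0, ract_zero]

namespace Lam

/-- The morphism of `Λ` with the given entries. -/
def mat {P Q : Lam M} (t : P.t ⟶ Q.t) (m : val M Q.u P.t) (u : P.u ⟶ Q.u) : P ⟶ Q :=
  Lam.Hom.mk t m u

@[simp] lemma mat_t {P Q : Lam M} (t : P.t ⟶ Q.t) (m : val M Q.u P.t) (u : P.u ⟶ Q.u) :
    (mat t m u).t = t := rfl
@[simp] lemma mat_m {P Q : Lam M} (t : P.t ⟶ Q.t) (m : val M Q.u P.t) (u : P.u ⟶ Q.u) :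
    (mat t m u).m = m := rfl
@[simp] lemma mat_u {P Q : Lam M} (t : P.t ⟶ Q.t) (m : val M Q.u P.t) (u : P.u ⟶ Q.u) :
    (mat t m u).u = u := rfl

lemma mat_add_corner {P Q : Lam M} (m n : val M Q.u P.t) :
    (mat 0 (m + n) 0 : P ⟶ Q) = mat 0 m 0 + mat 0 n 0 := by
  ext <;> simp

lemma mat_corner_comp {P Q Q' : Lam M} (m : val M Q.u P.t) (f : Q ⟶ Q') :
    (mat 0 m 0 : P ⟶ Q) ≫ f = mat 0 (lact M f.u P.t m) 0 := by
  ext <;> simp [ract_zero]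

lemma comp_mat_corner {P P' Q : Lam M} (f : P ⟶ P') (m : val M Q.u P'.t) :
    f ≫ (mat 0 m 0 : P' ⟶ Q) = mat 0 (ract M Q.u f.t m) 0 := by
  ext <;> simp [lact_zero]

variable (M) in
/-- The projection of `Λ` onto `T`. -/
def projT : Lam M ⥤ T where
  obj P := P.t
  map a := a.t

variable (M) in
/-- The projection of `Λ` onto `U`. -/
def projU : Lam M ⥤ U where
  obj P := P.u
  map a := a.u

instance : (projT M).Additive where

instance : (projU M).Additive where

variable (M) in
/-- The embedding of `T` into `Λ` with second component a fixed object `z`. -/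
def inclT {z : U} (_ : IsZero z) : T ⥤ Lam M where
  obj Y := ⟨Y, z⟩
  map t := mat t 0 (𝟙 z)
  map_comp _ _ := by ext <;> simp

variable (M) in
/-- The embedding of `U` into `Λ` with first component a fixed object `z`. -/
def inclU {z : T} (_ : IsZero z) : U ⥤ Lam M where
  obj X := ⟨z, X⟩
  map u := mat (𝟙 z) 0 u
  map_comp _ _ := by ext <;> simp

instance {z : U} (hz : IsZero z) : (inclT M hz).Additive where
  map_add := Lam.Hom.ext rfl (add_zero _).symm (hz.eq_of_src _ _)

instance {z : T} (hz : IsZero z) : (inclU M hz).Additive where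
  map_add := Lam.Hom.ext (hz.eq_of_src _ _) (add_zero _).symm rfl

/-- The morphism `M_T ⟶ N|_U`, `m ↦ N([0 0; m 0])(x)`, for `x ∈ N(T, U')`. -/
def cornerHom {z : T} (hz : IsZero z) (N : Mod (Lam M)) {P : Lam M} (x : N.obj.obj P) :
    atT M P.t ⟶ (res (inclU M hz)).obj N :=
  mkHom (M := atT M P.t) (N := (res (inclU M hz)).obj N)
    (fun X => AddMonoidHom.mk' (fun m => act N (mat (Q := ⟨z, X⟩) 0 m 0) x) (fun m n =>
      (congrArg (fun a => act N a x) (mat_add_corner (Q := ⟨z, X⟩) m n)).trans (act_add _ _ _ _)))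
    (fun {X X'} f m =>
      (congrArg (fun a => act N a x) (mat_corner_comp (Q := ⟨z, X⟩) (Q' := ⟨z, X'⟩) m
        (mat (𝟙 z) 0 f)).symm).trans
        (act_comp _ _ _ _))

/-- On representables there is an exact sequence 0 ⟶ M_T ⟶ Λ((T, U), (0, -)) ⟶ U(U, -) ⟶ 0, given by
the corner entry and the lower right entry. -/
lemma isFP_res_inclU {z : T} (hz : IsZero z) (hM : ∀ Y : T, IsFP (atT M Y)) {N : Mod (Lam M)}
    (hN : IsFP N) : IsFP ((res (inclU M hz)).obj N) := by
  refine hN.map (res (inclU M hz)) (fun η h X => h _) (fun ι η h X => h _) fun P => ?_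
  let p : (res (inclU M hz)).obj (rep P) ⟶ rep P.u :=
    mkHom (M := (res (inclU M hz)).obj (rep P)) (N := rep P.u)
      (fun X => AddMonoidHom.mk'
        (fun a => ULift.up (Lam.Hom.u (show ULift.{u} (P ⟶ ⟨z, X⟩) from a).down)) (fun _ _ => rfl))
      (fun f a => rfl)
  refine (hM P.t).of_extension (isFP_rep P.u) (cornerHom hz (rep P) (repId P)) p ?_ ?_ ?_
  · intro X m n h
    have h' := congrArg (fun a : ULift.{u} (P ⟶ (⟨z, X⟩ : Lam M)) => Lam.Hom.m a.down) h
    change (𝟙 P ≫ mat (Q := ⟨z, X⟩) 0 m 0 : P ⟶ ⟨z, X⟩).m =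
      (𝟙 P ≫ mat (Q := ⟨z, X⟩) 0 n 0 : P ⟶ ⟨z, X⟩).m at h'
    rw [Category.id_comp, Category.id_comp] at h'
    exact h'
  · intro X a
    constructor
    · intro h
      have h' : (ULift.down a : P ⟶ ⟨z, X⟩).u = 0 := congrArg ULift.down h
      refine ⟨(ULift.down a : P ⟶ ⟨z, X⟩).m, congrArg ULift.up ?_⟩
      change 𝟙 P ≫ mat (Q := ⟨z, X⟩) 0 _ 0 = _
      rw [Category.id_comp]
      exact Lam.Hom.ext (hz.eq_of_tgt _ _) rfl h'.symm
    · rintro ⟨m, rfl⟩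
      refine congrArg ULift.up ?_
      change (𝟙 P ≫ mat (Q := ⟨z, X⟩) 0 m 0 : P ⟶ ⟨z, X⟩).u = 0
      rw [Category.id_comp]
      rfl
  · intro X a
    exact ⟨ULift.up (mat 0 0 (ULift.down a) : P ⟶ ⟨z, X⟩), rfl⟩

/-- A morphism from (T, U) to (Y, 0) has no corner and no U-entry, so Λ((T, U), (-, 0)) is T(T, -).
-/
lemma isFP_res_inclT {z : U} (hz : IsZero z) {N : Mod (Lam M)}
    (hN : IsFP N) : IsFP ((res (inclT M hz)).obj N) := by
  refine hN.map (res (inclT M hz)) (fun η h X => h _) (fun ι η h X => h _) fun P => ?_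
  let ψ : rep P.t ⟶ (res (inclT M hz)).obj (rep P) :=
    repHom (M := (res (inclT M hz)).obj (rep P)) (X := P.t)
      (ULift.up (mat (𝟙 P.t) 0 0) : ULift.{u} (P ⟶ (⟨P.t, z⟩ : Lam M)))
  refine (isFP_rep P.t).of_bijective ψ fun Y => ⟨fun a b h => ?_, fun a => ?_⟩
  · have h' := congrArg (fun a : ULift.{u} (P ⟶ (⟨Y, z⟩ : Lam M)) => Lam.Hom.t a.down) h
    change 𝟙 P.t ≫ ULift.down a = 𝟙 P.t ≫ ULift.down b at h'
    rw [Category.id_comp, Category.id_comp] at h'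
    exact congrArg ULift.up h'
  · exact ⟨ULift.up (ULift.down a : P ⟶ ⟨Y, z⟩).t, congrArg ULift.up (Lam.Hom.ext
      (Category.id_comp _) ((val_eq_zero_of_isZero_left hz _).trans
        (val_eq_zero_of_isZero_left hz _).symm) (hz.eq_of_tgt _ _))⟩

/-- A morphism out of (0, X) is determined by its U-entry, so inflation sends U(X, -) to Λ((0, X),
-). -/
lemma isFP_res_projU {z : T} (hz : IsZero z) {B : Mod U} (hB : IsFP B) :
    IsFP (C := Lam M) ((res (projU M)).obj B) := by
  refine hB.map (res (projU M)) (fun η h X => h _) (fun ι η h X => h _) fun X => ?_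
  let ψ : rep (⟨z, X⟩ : Lam M) ⟶ (res (projU M)).obj (rep X) :=
    repHom (M := (res (projU M)).obj (rep X)) (X := ⟨z, X⟩) (repId X)
  refine (isFP_rep (⟨z, X⟩ : Lam M)).of_bijective ψ fun P => ⟨fun a b h => ?_, fun a => ?_⟩
  · have h' : 𝟙 X ≫ (ULift.down a : (⟨z, X⟩ : Lam M) ⟶ P).u =
      𝟙 X ≫ (ULift.down b : (⟨z, X⟩ : Lam M) ⟶ P).u := congrArg ULift.down h
    rw [Category.id_comp, Category.id_comp] at h'
    exact congrArg ULift.up (Lam.Hom.ext (hz.eq_of_src _ _) ((val_eq_zero_of_isZero_right hz _).trans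
      (val_eq_zero_of_isZero_right hz _).symm) h')
  · exact ⟨ULift.up (mat 0 0 (ULift.down a) : ⟨z, X⟩ ⟶ P),
      congrArg ULift.up (Category.id_comp _)⟩

/-- The embedding of `M_T` into the `Λ`-module represented by `(T, z)`. -/
def cornerIncl {z : U} (Y : T) :
    (res (projU M)).obj (atT M Y) ⟶ rep (⟨Y, z⟩ : Lam M) :=
  mkHom (M := (res (projU M)).obj (atT M Y)) (N := rep (⟨Y, z⟩ : Lam M))
    (fun P => AddMonoidHom.mk' (fun m => ULift.up (mat (P := ⟨Y, z⟩) (Q := P) 0 m 0))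
      (fun m n => congrArg ULift.up (mat_add_corner (P := ⟨Y, z⟩) (Q := P) m n)))
    (fun {P _} f m => congrArg ULift.up (mat_corner_comp (P := ⟨Y, z⟩) (Q := P) m f).symm)

/-- Taking the T-entry maps Λ((Y, 0), -) onto the inflation of T(Y, -). The kernel consists of the
corner entries, which form the inflation of M_Y, finitely generated by `isFP_res_projU`. -/
lemma isFP_res_projT {z : U} (hz : IsZero z) {z' : T} (hz' : IsZero z')
    (hM : ∀ Y : T, IsFP (atT M Y)) {A : Mod T} (hA : IsFP A) :
    IsFP (C := Lam M) ((res (projT M)).obj A) := by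
  refine hA.map (res (projT M)) (fun η h X => h _) (fun ι η h X => h _) fun Y => ?_
  let ψ : rep (⟨Y, z⟩ : Lam M) ⟶ (res (projT M)).obj (rep Y) :=
    repHom (M := (res (projT M)).obj (rep Y)) (X := ⟨Y, z⟩) (repId Y)
  refine (isFP_rep (⟨Y, z⟩ : Lam M)).of_surjective ψ (fun P a => ?_)
    (.ker_of_exact (cornerIncl Y) ψ (fun P a => ⟨fun h => ?_, ?_⟩)
      (isFP_res_projU hz' (hM Y)).isFG)
  · exact ⟨ULift.up (mat (ULift.down a) 0 0 : ⟨Y, z⟩ ⟶ P),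
      congrArg ULift.up (Category.id_comp _)⟩
  · have h' : 𝟙 Y ≫ (ULift.down a : (⟨Y, z⟩ : Lam M) ⟶ P).t = 0 := congrArg ULift.down h
    rw [Category.id_comp] at h'
    exact ⟨(ULift.down a : (⟨Y, z⟩ : Lam M) ⟶ P).m,
      congrArg ULift.up (Lam.Hom.ext h'.symm rfl (hz.eq_of_src _ _))⟩
  · rintro ⟨m, rfl⟩
    exact congrArg ULift.up (Category.id_comp (0 : Y ⟶ P.t))

end Lam

/-! ### The functor `𝔉` -/

/-- The second summand is a submodule, because the matrices of Λ are lower triangular; this gives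
the extension of A by B, both inflated to Λ. -/
lemma isFP_FObj {z : U} (hz : IsZero z) {z' : T} (hz' : IsZero z')
    (hM : ∀ Y : T, IsFP (atT M Y)) {Z : CommaMod M} (hA : IsFP Z.left) (hB : IsFP Z.right) :
    IsFP (FObj Z) := by
  let ι : (res (Lam.projU M)).obj Z.right ⟶ FObj Z :=
    mkHom (M := (res (Lam.projU M)).obj Z.right) (N := FObj Z)
      (fun P => AddMonoidHom.inr (Z.left.obj.obj P.t) (Z.right.obj.obj P.u))
      (fun a y => Prod.ext (map_zero (act Z.left a.t)).symm (by
        change _ = dot Z a.m 0 + act Z.right a.u y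
        rw [dot_zero_right, zero_add]
        rfl))
  let p : FObj Z ⟶ (res (Lam.projT M)).obj Z.left :=
    mkHom (M := FObj Z) (N := (res (Lam.projT M)).obj Z.left)
      (fun P => AddMonoidHom.fst (Z.left.obj.obj P.t) (Z.right.obj.obj P.u)) (fun a y => rfl)
  refine (Lam.isFP_res_projU hz' hB).of_extension (Lam.isFP_res_projT hz hz' hM hA) ι p ?_ ?_ ?_
  · exact fun P x y h => congrArg Prod.snd h
  · exact fun P x => ⟨fun h => ⟨x.2, Prod.ext h.symm rfl⟩, by rintro ⟨y, rfl⟩; rfl⟩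
  · exact fun P x => ⟨(x, 0), rfl⟩

/-- The objects z and z' are mere placeholders here and in `full_F`: one coordinate is tested while
the other is filled with an arbitrary object. -/
lemma faithful_F (z : U) (z' : T) : (F M).Faithful := by
  refine ⟨fun {Z W φ ψ} h => ?_⟩
  have h' : ∀ (P : Lam M) (x : Z.left.obj.obj P.t) (y : Z.right.obj.obj P.u),
      (app φ.left P.t x, app φ.right P.u y) = (app ψ.left P.t x, app ψ.right P.u y) :=
    fun P x y => congrArg (fun θ => app θ P (x, y)) h
  apply CommaMorphism.ext
  · exact hom_ext fun Y x => congrArg Prod.fst (h' ⟨Y, z⟩ x 0)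
  · exact hom_ext fun X y => congrArg Prod.snd (h' ⟨z', X⟩ 0 y)

lemma full_F (z : U) (z' : T) : (F M).Full := by
  refine ⟨fun {Z W} η => ?_⟩
  let e (P : Lam M) : Z.left.obj.obj P.t × Z.right.obj.obj P.u →+
    W.left.obj.obj P.t × W.right.obj.obj P.u := app η P
  have he : ∀ {P Q : Lam M} (a : P ⟶ Q) (x : Z.left.obj.obj P.t) (y : Z.right.obj.obj P.u),
      e Q (act Z.left a.t x, dot Z a.m x + act Z.right a.u y) =
        (act W.left a.t (e P (x, y)).1, dot W a.m (e P (x, y)).1 + act W.right a.u (e P (x, y)).2) :=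
    fun a x y => app_act η a (x, y)
  let α : Z.left ⟶ W.left := mkHom
    (fun Y => (AddMonoidHom.fst _ _).comp ((e ⟨Y, z⟩).comp (AddMonoidHom.inl _ _)))
    (fun {Y Y'} t x => by
      have := congrArg Prod.fst (he (Lam.mat (P := ⟨Y, z⟩) (Q := ⟨Y', z⟩) t 0 0) x 0)
      simpa using this)
  let β : Z.right ⟶ W.right := mkHom
    (fun X => (AddMonoidHom.snd _ _).comp ((e ⟨z', X⟩).comp (AddMonoidHom.inr _ _)))
    (fun {X X'} f y => by
      have := congrArg Prod.snd (he (Lam.mat (P := ⟨z', X⟩) (Q := ⟨z', X'⟩) 0 0 f) 0 y)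
      simpa using this)
  have hα : ∀ Y x, app α Y x = (e ⟨Y, z⟩ (x, 0)).1 := fun _ _ => rfl
  have hβ : ∀ X y, app β X y = (e ⟨z', X⟩ (0, y)).2 := fun _ _ => rfl
  -- Naturality of η at a pure corner matrix is exactly the commutation of (α, β) with the structure
  -- maps.
  have hdot : ∀ {X Y} (m : val M X Y) (x : Z.left.obj.obj Y),
      dot W m (app α Y x) = app β X (dot Z m x) := by
    intro X Y m x
    have := congrArg Prod.snd (he (Lam.mat (P := ⟨Y, z⟩) (Q := ⟨z', X⟩) 0 m 0) x 0)
    simpa [hα, hβ] using this.symm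
  refine ⟨⟨α, β, hom_ext fun Y x => hom_ext fun X m => hdot m x⟩, hom_ext fun P x => ?_⟩
  obtain ⟨x, y⟩ := x
  change (app α P.t x, app β P.u y) = e P (x, y)
  -- Naturality at the two diagonal idempotent-like matrices shows that η has no off-diagonal part
  -- and that its diagonal parts do not depend on the other coordinate.
  have h1 := he (Lam.mat (P := ⟨P.t, z⟩) (Q := P) (𝟙 _) 0 0) x 0
  have h2 := he (Lam.mat (P := ⟨z', P.u⟩) (Q := P) 0 0 (𝟙 _)) 0 y
  have h3 : e P (x, y) = e P (x, 0) + e P (0, y) := by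
    rw [← map_add]; simp
  simp at h1 h2
  rw [h3, h1, h2, hα, hβ]
  simp

/-- The triple `(N(-, 0), f, N(0, -))` of a `Λ`-module `N`, where `f` is given by the action of the
matrices `[0 0; m 0]`. -/
def toComma {z : U} (hz : IsZero z) {z' : T} (hz' : IsZero z') (N : Mod (Lam M)) : CommaMod M where
  left := (res (Lam.inclT M hz)).obj N
  right := (res (Lam.inclU M hz')).obj N
  hom := mkHom (M := (res (Lam.inclT M hz)).obj N) (N := gObj M ((res (Lam.inclU M hz')).obj N))
    (fun Y => AddMonoidHom.mk' (fun x => Lam.cornerHom hz' N (P := ⟨Y, z⟩) x)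
      (fun x y => hom_ext fun _ _ => map_add (act N _) x y))
    (fun {Y Y'} t x => hom_ext fun X m =>
      (act_comp N _ _ _).symm.trans (congrArg (fun a => act N a x) (Lam.comp_mat_corner
        (P := ⟨Y, z⟩) (P' := ⟨Y', z⟩) (Q := ⟨z', X⟩) (Lam.mat t 0 (𝟙 z)) m)))

namespace Lam

/-- The inclusion of `(T, z)` into `(T, U)`. -/
def inl (z : U) (P : Lam M) : (⟨P.t, z⟩ : Lam M) ⟶ P := mat (P := ⟨P.t, z⟩) (𝟙 _) 0 0

/-- The inclusion of `(z, U)` into `(T, U)`. -/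
def inr (z : T) (P : Lam M) : (⟨z, P.u⟩ : Lam M) ⟶ P := mat (P := ⟨z, P.u⟩) 0 0 (𝟙 _)

/-- The projection of `(T, U)` onto `(T, z)`. -/
def fst (z : U) (P : Lam M) : P ⟶ (⟨P.t, z⟩ : Lam M) := mat (Q := ⟨P.t, z⟩) (𝟙 _) 0 0

/-- The projection of `(T, U)` onto `(z, U)`. -/
def snd (z : T) (P : Lam M) : P ⟶ (⟨z, P.u⟩ : Lam M) := mat (Q := ⟨z, P.u⟩) 0 0 (𝟙 _)

/-- The `T`-component of a morphism of `Λ`. -/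
def compT (z : U) {P Q : Lam M} (a : P ⟶ Q) : (⟨P.t, z⟩ : Lam M) ⟶ ⟨Q.t, z⟩ :=
  mat (P := ⟨P.t, z⟩) (Q := ⟨Q.t, z⟩) a.t 0 (𝟙 z)

/-- The `U`-component of a morphism of `Λ`. -/
def compU (z : T) {P Q : Lam M} (a : P ⟶ Q) : (⟨z, P.u⟩ : Lam M) ⟶ ⟨z, Q.u⟩ :=
  mat (P := ⟨z, P.u⟩) (Q := ⟨z, Q.u⟩) (𝟙 z) 0 a.u

/-- The corner of a morphism of `Λ`. -/
def corner (z : U) (z' : T) {P Q : Lam M} (a : P ⟶ Q) : (⟨P.t, z⟩ : Lam M) ⟶ ⟨z', Q.u⟩ :=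
  mat (P := ⟨P.t, z⟩) (Q := ⟨z', Q.u⟩) 0 a.m 0

/-- Together with `inr_comp`, `comp_fst` and `comp_snd`, this splits a matrix into its entries;
these identities become naturality of the isomorphism with N and of its inverse. -/
lemma inl_comp (z : U) (z' : T) {P Q : Lam M} (a : P ⟶ Q) :
    inl z P ≫ a = compT z a ≫ inl z Q + corner z z' a ≫ inr z' Q := by
  ext <;> simp [inl, inr, corner, compT, lact_zero]

lemma inr_comp (z' : T) {P Q : Lam M} (a : P ⟶ Q) :
    inr z' P ≫ a = compU z' a ≫ inr z' Q := by
  ext <;> simp [inr, compU, ract_zero]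

lemma comp_fst (z : U) {P Q : Lam M} (a : P ⟶ Q) :
    a ≫ fst z Q = fst z P ≫ compT z a := by
  ext <;> simp [fst, compT, lact_zero]

lemma comp_snd (z : U) (z' : T) {P Q : Lam M} (a : P ⟶ Q) :
    a ≫ snd z' Q = fst z P ≫ corner z z' a + snd z' P ≫ compU z' a := by
  ext <;> simp [fst, snd, corner, compU, ract_zero]

/-- Here z must be a zero object: the composite has lower right entry 0, which has to be the
identity of z. -/
lemma inl_fst {z : U} (hz : IsZero z) (P : Lam M) : inl z P ≫ fst z P = 𝟙 _ :=
  Lam.Hom.ext (Category.id_comp _) ((val_eq_zero_of_isZero_left hz _).trans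
    (val_eq_zero_of_isZero_left hz _).symm) (hz.eq_of_src _ _)

lemma inr_snd {z' : T} (hz' : IsZero z') (P : Lam M) : inr z' P ≫ snd z' P = 𝟙 _ :=
  Lam.Hom.ext (hz'.eq_of_src _ _) ((val_eq_zero_of_isZero_right hz' _).trans
    (val_eq_zero_of_isZero_right hz' _).symm) (Category.id_comp _)

lemma inl_snd (z : U) (z' : T) (P : Lam M) : inl z P ≫ snd z' P = 0 := by
  apply Lam.Hom.ext <;> simp [inl, snd] <;> rfl

lemma inr_fst (z : U) (z' : T) (P : Lam M) : inr z' P ≫ fst z P = 0 := by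
  apply Lam.Hom.ext <;> simp [inr, fst] <;> rfl

lemma fst_inl_add_snd_inr (z : U) (z' : T) (P : Lam M) :
    fst z P ≫ inl z P + snd z' P ≫ inr z' P = 𝟙 P := by
  ext <;> simp [inl, fst, inr, snd]

lemma act_inl_add_inr (z : U) (z' : T) (N : Mod (Lam M)) {P Q : Lam M} (a : P ⟶ Q)
    (x : N.obj.obj ⟨P.t, z⟩) (y : N.obj.obj ⟨z', P.u⟩) :
    act N (inl z Q) (act N (compT z a) x) +
        act N (inr z' Q) (act N (corner z z' a) x + act N (compU z' a) y) =
      act N a (act N (inl z P) x + act N (inr z' P) y) := by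
  simp only [map_add, ← act_comp]
  rw [inl_comp z z', inr_comp, act_add, add_assoc]

lemma act_fst (z : U) (N : Mod (Lam M)) {P Q : Lam M} (a : P ⟶ Q) (x : N.obj.obj P) :
    act N (fst z Q) (act N a x) = act N (compT z a) (act N (fst z P) x) := by
  rw [← act_comp, ← act_comp, comp_fst]

lemma act_snd (z : U) (z' : T) (N : Mod (Lam M)) {P Q : Lam M} (a : P ⟶ Q) (x : N.obj.obj P) :
    act N (snd z' Q) (act N a x) =
      act N (corner z z' a) (act N (fst z P) x) + act N (compU z' a) (act N (snd z' P) x) := by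
  rw [← act_comp, ← act_comp, ← act_comp, comp_snd z, act_add]

lemma act_fst_inl_add_inr {z : U} (hz : IsZero z) (z' : T) (N : Mod (Lam M)) (P : Lam M)
    (x : N.obj.obj ⟨P.t, z⟩) (y : N.obj.obj ⟨z', P.u⟩) :
    act N (fst z P) (act N (inl z P) x + act N (inr z' P) y) = x := by
  rw [map_add, ← act_comp, ← act_comp, inl_fst hz, inr_fst, act_zero, add_zero, act_id]

lemma act_snd_inl_add_inr (z : U) {z' : T} (hz' : IsZero z') (N : Mod (Lam M)) (P : Lam M)
    (x : N.obj.obj ⟨P.t, z⟩) (y : N.obj.obj ⟨z', P.u⟩) :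
    act N (snd z' P) (act N (inl z P) x + act N (inr z' P) y) = y := by
  rw [map_add, ← act_comp, ← act_comp, inr_snd hz', inl_snd, act_zero, zero_add, act_id]

end Lam

/-- Every `Λ`-module `N` is isomorphic to the one given by the triple `(N(-, 0), f, N(0, -))`. -/
def FObjToCommaIso {z : U} (hz : IsZero z) {z' : T} (hz' : IsZero z') (N : Mod (Lam M)) :
    FObj (toComma hz hz' N) ≅ N where
  hom := mkHom (M := FObj (toComma hz hz' N)) (N := N)
    (fun P => (act N (Lam.inl z P)).coprod (act N (Lam.inr z' P)))
    (fun a p => Lam.act_inl_add_inr z z' N a p.1 p.2)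
  inv := mkHom (M := N) (N := FObj (toComma hz hz' N))
    (fun P => (act N (Lam.fst z P)).prod (act N (Lam.snd z' P)))
    (fun a x => Prod.ext (Lam.act_fst z N a x) (Lam.act_snd z z' N a x))
  hom_inv_id := hom_ext fun P p =>
    Prod.ext (Lam.act_fst_inl_add_inr hz z' N P p.1 p.2) (Lam.act_snd_inl_add_inr z hz' N P p.1 p.2)
  inv_hom_id := hom_ext fun P x => by
    change act N (Lam.inl z P) (act N (Lam.fst z P) x) +
      act N (Lam.inr z' P) (act N (Lam.snd z' P) x) = x
    rw [← act_comp, ← act_comp, ← act_add, Lam.fst_inl_add_snd_inr, act_id]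

end Bimodule

end

end TriMat

/-! ### The equivalence on finitely presented modules -/

theorem mainTheorem6 {K : Type v} [Field K] {U T : Type u} [Category.{v} U] [Category.{v} T]
    [Preadditive U] [Preadditive T] [Linear K U] [Linear K T]
    (hU : TriMat.IsDualizingVariety K U) (hT : TriMat.IsDualizingVariety K T)
    (M : TriMat.Mod (TriMat.TensorCat K U Tᵒᵖ))
    (hMT : ∀ Y : T, TriMat.IsFP (TriMat.atT M Y))
    (hMU : ∀ X : U, TriMat.IsFP (TriMat.atU M X)) :
    ∃ h : ∀ Z : (TriMat.IsFPComma M).FullSubcategory,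
        TriMat.IsFP (((TriMat.IsFPComma M).ι ⋙ TriMat.F M).obj Z),
      (TriMat.IsFP.lift ((TriMat.IsFPComma M).ι ⋙ TriMat.F M) h).IsEquivalence := by
  have := hU.hasFiniteBiproducts
  have := hT.hasFiniteBiproducts
  -- Zero objects are the empty biproducts.
  obtain ⟨z, hz⟩ := HasZeroObject.zero (C := U)
  obtain ⟨z', hz'⟩ := HasZeroObject.zero (C := T)
  have := TriMat.faithful_F (M := M) z z'
  have := TriMat.full_F (M := M) z z'
  have h : ∀ Z, TriMat.IsFP (((TriMat.IsFPComma M).ι ⋙ TriMat.F M).obj Z) :=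
    fun Z => TriMat.isFP_FObj hz hz' hMT Z.property.1 Z.property.2
  refine ⟨h, { faithful := ?_, full := ?_, essSurj := ⟨fun N => ?_⟩ }⟩
  · infer_instance
  · infer_instance
  -- The triple of a finitely presented N has finitely presented components, so the isomorphism with
  -- N already lives in mod(Λ).
  exact ⟨⟨TriMat.toComma hz hz' N.obj, TriMat.Lam.isFP_res_inclT hz N.property,
    TriMat.Lam.isFP_res_inclU hz' hMT N.property⟩,
    ⟨ObjectProperty.isoMk _ (TriMat.FObjToCommaIso hz hz' N.obj)⟩⟩
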